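/- Let $\mathbb F$ be an algebraically closed field of characteristic $0$. For integers $\ell_2,\ell_3\ge 0$, an additive subgroup of the space $\mathbb F^{\ell_2+\ell_3}$ of row vectors is called nondegenerate if it contains an $\mathbb F$-basis of $\mathbb F^{\ell_2+\ell_3}$ (for $\ell_2+\ell_3=0$ the only subgroup is $\{0\}$, and it counts as nondegenerate); let $\Omega_{\ell_2+\ell_3}$ be the set of nondegenerate additive subgroups. Let $\ell_1,\ell_2,\ell_3\ge 0$ be integers with $\ell_1+\ell_2+\ell_3>0$ and let $\Gamma\in\Omega_{\ell_2+\ell_3}$. Let $\mathcal A(\ell_1,\ell_2,\ell_3;\Gamma)$ be the free $\mathbb F[t_1,\dots,t_{\ell_1+\ell_2}]$-module with basis $\{x^\alpha\mid\alpha\in\Gamma\}$, made into a commutative associative $\mathbb F$-algebra by $(\zeta x^\alpha)(\eta x^\beta)=\zeta\eta\,x^{\alpha+\beta}$. On it consider the derivations $\partial_{t_i}(\zeta x^\alpha)=\partial_{t_i}(\zeta)x^\alpha$ for $1\le i\le \ell_1+\ell_2$ and $\partial^*_j(\zeta x^\alpha)=\alpha_j\zeta x^\alpha$ for $1\le j\le\ell_2+\ell_3$,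 and put $$\partial_i=\partial_{t_i}\ (1\le i\le\ell_1),\qquad \partial_{\ell_1+j}=\partial^*_j+\partial_{t_{\ell_1+j}}\ (1\le j\le\ell_2),\qquad \partial_{\ell_1+\ell_2+l}=\partial^*_{\ell_2+l}\ (1\le l\le\ell_3).$$ Let $\mathcal D=\sum_{i=1}^{\ell_1+\ell_2+\ell_3}\mathbb F\,\partial_i$, and let $\mathcal W(\ell_1,\ell_2,\ell_3;\Gamma)=\mathcal A(\ell_1,\ell_2,\ell_3;\Gamma)\,\mathcal D$ be the $\mathbb F$-Lie algebra of all derivations $\sum_i u_i\partial_i$ with $u_i\in\mathcal A(\ell_1,\ell_2,\ell_3;\Gamma)$, under the commutator bracket. Let $$G_{\ell_2,\ell_3}=\left\{\begin{pmatrix}A&0\\B&C\end{pmatrix}\ \middle|\ A\in GL_{\ell_2}(\mathbb F),\ B\in M_{\ell_3\times\ell_2}(\mathbb F),\ C\in GL_{\ell_3}(\mathbb F)\right\},$$ acting on row vectors by $g(\alpha)=\alpha g^{-1}$, and hence on $\Omega_{\ell_2+\ell_3}$ by $g(\Gamma)=\{g(\alpha)\mid\alpha\in\Gamma\}$. Let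 $\mathcal M_{\ell_2,\ell_3}=\Omega_{\ell_2+\ell_3}/G_{\ell_2,\ell_3}$ be the set of orbits. **Theorem 3.1.** Let $\ell_1,\ell_2,\ell_3$ and $\ell_1',\ell_2',\ell_3'$ be triples of nonnegative integers, each with positive sum, and let $\Gamma\in\Omega_{\ell_2+\ell_3}$, $\Gamma'\in\Omega_{\ell_2'+\ell_3'}$. The Lie algebras $\mathcal W(\ell_1,\ell_2,\ell_3;\Gamma)$ and $\mathcal W(\ell_1',\ell_2',\ell_3';\Gamma')$ are isomorphic over $\mathbb F$ if and only if $(\ell_1,\ell_2,\ell_3)=(\ell_1',\ell_2',\ell_3')$ and there exists $g\in G_{\ell_2,\ell_3}$ with $g(\Gamma)=\Gamma'$. Consequently, sending the isomorphism class of $\mathcal W(\ell_1,\ell_2,\ell_3;\Gamma)$ to $(\ell_1,\ell_2,\ell_3,G_{\ell_2,\ell_3}\cdot\Gamma)$ is a well-defined bijection from the set of isomorphism classes of the Lie algebras of this form onto $$SW=\{(\ell_1,\ell_2,\ell_3,\varpi)\mid (0,0,0)\ne(\ell_1,\ell_2,\ell_3)\in\mathbb N^3,\ \varpi\in\mathcal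 M_{\ell_2,\ell_3}\}.$$ -/

import Mathlib

noncomputable section

namespace WittType

open Matrix

section General

variable {F A : Type*} [Field F] [CommRing A] [Algebra F A]

/-- The product of two elements of the `A`-span of a commuting set of derivations is again in it. -/
theorem lie_mem_span {S : Set (Derivation F A A)} (hS : ∀ d ∈ S, ∀ e ∈ S, ⁅d, e⁆ = 0)
    {x y : Derivation F A A} (hx : x ∈ Submodule.span A S) (hy : y ∈ Submodule.span A S) :
    ⁅x, y⁆ ∈ Submodule.span A S := by
  have key : ∀ (a : A) (d e : Derivation F A A), ⁅d, a • e⁆ = d a • e + a • ⁅d, e⁆ := by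
    intro a d e
    ext b
    simp only [Derivation.commutator_apply, Derivation.smul_apply, Derivation.add_apply,
      smul_eq_mul, Derivation.leibniz]
    ring
  induction hy using Submodule.span_induction with
  | zero => simp
  | add y z _ _ h1 h2 => rw [lie_add]; exact add_mem h1 h2
  | smul a y hy h =>
    rw [key]
    exact add_mem (Submodule.smul_mem _ _ hy) (Submodule.smul_mem _ _ h)
  | mem e he =>
    induction hx using Submodule.span_induction with
    | zero => simp
    | add y z _ _ h1 h2 => rw [add_lie]; exact add_mem h1 h2
    | smul a y hy h =>
      rw [← lie_skew, key, ← lie_skew e y]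
      refine neg_mem (add_mem (Submodule.smul_mem _ _ hy) ?_)
      exact Submodule.smul_mem _ _ (neg_mem h)
    | mem d hd => rw [hS d hd e he]; exact zero_mem _

/-- The Lie algebra `𝒲 = 𝒜𝒟` of a commutative algebra `𝒜` and a commutative space `𝒟` of
derivations of `𝒜`: all finite sums `∑ uᵢ dᵢ` with `uᵢ ∈ 𝒜`, `dᵢ ∈ 𝒟`, with the commutator bracket
of derivations. -/
def lieOf (D : Submodule F (Derivation F A A)) (hD : ∀ d ∈ D, ∀ e ∈ D, ⁅d, e⁆ = 0) :
    LieSubalgebra F (Derivation F A A) where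
  toSubmodule := (Submodule.span A (D : Set (Derivation F A A))).restrictScalars F
  lie_mem' := fun hx hy => lie_mem_span (S := (D : Set (Derivation F A A))) hD hx hy

end General

variable {F : Type*} [Field F]

/-- The space `𝔽^{ℓ₂+ℓ₃}` of row vectors; the first `ℓ₂` coordinates are indexed by `Sum.inl j`, the
last `ℓ₃` by `Sum.inr l`. -/
abbrev Row (F : Type*) (ℓ₂ ℓ₃ : ℕ) : Type _ := Fin ℓ₂ ⊕ Fin ℓ₃ → F

/-- An additive subgroup of `𝔽^{ℓ₂+ℓ₃}` is nondegenerate if it contains an `𝔽`-basis of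
`𝔽^{ℓ₂+ℓ₃}`. (For `ℓ₂ + ℓ₃ = 0` this holds for the only subgroup, `{0}`.) -/
def IsNondegenerate {ℓ₂ ℓ₃ : ℕ} (Γ : AddSubgroup (Row F ℓ₂ ℓ₃)) : Prop :=
  ∃ b : Module.Basis (Fin ℓ₂ ⊕ Fin ℓ₃) F (Row F ℓ₂ ℓ₃), ∀ i, b i ∈ Γ

/-- The set `Ω_{ℓ₂+ℓ₃}` of nondegenerate additive subgroups of `𝔽^{ℓ₂+ℓ₃}`. -/
def Omega (F : Type*) [Field F] (ℓ₂ ℓ₃ : ℕ) : Type _ :=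
  {Γ : AddSubgroup (Row F ℓ₂ ℓ₃) // IsNondegenerate Γ}

/-- The algebra `𝒜(ℓ₁,ℓ₂,ℓ₃;Γ)`: free module over the polynomials in `t₁,…,t_{ℓ₁+ℓ₂}` with basis
`x^α`, `α ∈ Γ`, and product `ζ x^α ⬝ η x^β = ζ η x^{α+β}`. The variables `t₁,…,t_{ℓ₁}` are indexed
by `Sum.inl i`, the variables `t_{ℓ₁+1},…,t_{ℓ₁+ℓ₂}` by `Sum.inr j`. -/
def Alg (ℓ₁ : ℕ) {ℓ₂ ℓ₃ : ℕ} (Γ : AddSubgroup (Row F ℓ₂ ℓ₃)) : Type _ :=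
  AddMonoidAlgebra (MvPolynomial (Fin ℓ₁ ⊕ Fin ℓ₂) F) Γ

section Derivations

variable {ℓ₁ ℓ₂ ℓ₃ : ℕ} {Γ : AddSubgroup (Row F ℓ₂ ℓ₃)}

instance instCommRingAlg : CommRing (Alg ℓ₁ Γ) :=
  inferInstanceAs (CommRing (AddMonoidAlgebra (MvPolynomial (Fin ℓ₁ ⊕ Fin ℓ₂) F) Γ))

instance instAlgebraAlg : Algebra F (Alg ℓ₁ Γ) :=
  inferInstanceAs (Algebra F (AddMonoidAlgebra (MvPolynomial (Fin ℓ₁ ⊕ Fin ℓ₂) F) Γ))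

/-- The element `ζ x^α`. -/
def mono (α : Γ) (ζ : MvPolynomial (Fin ℓ₁ ⊕ Fin ℓ₂) F) : Alg ℓ₁ Γ :=
  AddMonoidAlgebra.single (R := MvPolynomial (Fin ℓ₁ ⊕ Fin ℓ₂) F) α ζ

theorem mono_add (α : Γ) (ζ η : MvPolynomial (Fin ℓ₁ ⊕ Fin ℓ₂) F) :
    mono α (ζ + η) = mono α ζ + mono α η :=
  AddMonoidAlgebra.single_add _ _ _

theorem mono_smul (c : F) (α : Γ) (ζ : MvPolynomial (Fin ℓ₁ ⊕ Fin ℓ₂) F) :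
    mono α (c • ζ) = c • mono α ζ :=
  (AddMonoidAlgebra.smul_single c α ζ).symm

theorem mono_mul_mono (α β : Γ) (ζ η : MvPolynomial (Fin ℓ₁ ⊕ Fin ℓ₂) F) :
    mono α ζ * mono β η = mono (α + β) (ζ * η) :=
  AddMonoidAlgebra.single_mul_single _ _ _ _

theorem mono_induction {p : Alg ℓ₁ Γ → Prop} (u : Alg ℓ₁ Γ) (zero : p 0)
    (add : ∀ f g, p f → p g → p (f + g)) (mono : ∀ α ζ, p (mono α ζ)) : p u :=
  AddMonoidAlgebra.induction_linear (motive := p) u zero (fun f g => add f g)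
    (fun α ζ => mono α ζ)

/-- The `𝔽`-linear map `ζ x^α ↦ T_α(ζ) x^α`. -/
def coeffMap (T : Γ → MvPolynomial (Fin ℓ₁ ⊕ Fin ℓ₂) F →ₗ[F] MvPolynomial (Fin ℓ₁ ⊕ Fin ℓ₂) F) :
    Alg ℓ₁ Γ →ₗ[F] Alg ℓ₁ Γ where
  toFun u := (AddMonoidAlgebra.coeff u).sum fun α ζ => mono α (T α ζ)
  map_add' u v := by
    have h : AddMonoidAlgebra.coeff (u + v) =
      AddMonoidAlgebra.coeff u + AddMonoidAlgebra.coeff v := rfl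
    rw [h, Finsupp.sum_add_index']
    · intro α; rw [map_zero]; exact AddMonoidAlgebra.single_zero α
    · intro α ζ η; rw [map_add, mono_add]
  map_smul' c u := by
    have h : AddMonoidAlgebra.coeff (c • u) = c • AddMonoidAlgebra.coeff u := rfl
    rw [h, Finsupp.sum_smul_index', Finsupp.smul_sum]
    · simp only [map_smul, mono_smul, RingHom.id_apply]
    · intro α; rw [map_zero]; exact AddMonoidAlgebra.single_zero α

theorem coeffMap_mono
    (T : Γ → MvPolynomial (Fin ℓ₁ ⊕ Fin ℓ₂) F →ₗ[F] MvPolynomial (Fin ℓ₁ ⊕ Fin ℓ₂) F)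
    (α : Γ) (ζ : MvPolynomial (Fin ℓ₁ ⊕ Fin ℓ₂) F) :
    coeffMap T (mono α ζ) = mono α (T α ζ) := by
  change (Finsupp.single α ζ).sum (fun α ζ => mono α (T α ζ)) = _
  rw [Finsupp.sum_single_index]
  rw [map_zero]; exact AddMonoidAlgebra.single_zero α

/-- The derivation `ζ x^α ↦ T_α(ζ) x^α`, for maps `T_α` that satisfy the corresponding product
rule. -/
def coeffDer (T : Γ → MvPolynomial (Fin ℓ₁ ⊕ Fin ℓ₂) F →ₗ[F] MvPolynomial (Fin ℓ₁ ⊕ Fin ℓ₂) F)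
    (hT : ∀ α β ζ η, T (α + β) (ζ * η) = ζ * T β η + η * T α ζ) :
    Derivation F (Alg ℓ₁ Γ) (Alg ℓ₁ Γ) :=
  Derivation.mk' (coeffMap T) (by
    intro u v
    induction u using mono_induction with
    | zero => simp
    | add f g hf hg => rw [add_mul, map_add, map_add, hf, hg, add_smul, smul_add]; abel
    | mono α ζ =>
      induction v using mono_induction with
      | zero => simp
      | add f g hf hg => rw [mul_add, map_add, map_add, hf, hg, add_smul, smul_add]; abel
      | mono β η =>
        simp only [mono_mul_mono, coeffMap_mono, smul_eq_mul, hT, mono_add, add_comm β α])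

/-- The down-grading operator `∂_{tᵢ}(ζ x^α) = ∂_{tᵢ}(ζ) x^α`. -/
def dt (Γ : AddSubgroup (Row F ℓ₂ ℓ₃)) (i : Fin ℓ₁ ⊕ Fin ℓ₂) :
    Derivation F (Alg ℓ₁ Γ) (Alg ℓ₁ Γ) :=
  coeffDer (fun _ => (MvPolynomial.pderiv i).toLinearMap) (by
    intro α β ζ η
    simp)

/-- The grading operator `∂*ⱼ(ζ x^α) = αⱼ ζ x^α`. -/
def dstar (ℓ₁ : ℕ) (Γ : AddSubgroup (Row F ℓ₂ ℓ₃)) (j : Fin ℓ₂ ⊕ Fin ℓ₃) :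
    Derivation F (Alg ℓ₁ Γ) (Alg ℓ₁ Γ) :=
  coeffDer (fun α => (α : Row F ℓ₂ ℓ₃) j • LinearMap.id) (by
    intro α β ζ η
    simp only [AddSubgroup.coe_add, Pi.add_apply, LinearMap.add_apply, LinearMap.smul_apply,
      LinearMap.id_apply, add_smul, mul_smul_comm, mul_comm η ζ]
    rw [add_comm])

theorem dt_mono (i : Fin ℓ₁ ⊕ Fin ℓ₂) (α : Γ) (ζ : MvPolynomial (Fin ℓ₁ ⊕ Fin ℓ₂) F) :
    dt Γ i (mono α ζ) = mono α (MvPolynomial.pderiv i ζ) :=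
  coeffMap_mono _ α ζ

theorem dstar_mono (j : Fin ℓ₂ ⊕ Fin ℓ₃) (α : Γ) (ζ : MvPolynomial (Fin ℓ₁ ⊕ Fin ℓ₂) F) :
    dstar ℓ₁ Γ j (mono α ζ) =
      mono α ((α : Row F ℓ₂ ℓ₃) j • ζ) :=
  coeffMap_mono _ α ζ

/-- The derivations `∂₁,…,∂_ℓ`, `ℓ = ℓ₁ + ℓ₂ + ℓ₃`: first the `∂_{tᵢ}` for `i ≤ ℓ₁`, then the
`∂*ⱼ + ∂_{t_{ℓ₁+j}}` for `j ≤ ℓ₂`, then the `∂*_{ℓ₂+l}` for `l ≤ ℓ₃`. -/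
def del (ℓ₁ : ℕ) (Γ : AddSubgroup (Row F ℓ₂ ℓ₃)) :
    Fin ℓ₁ ⊕ Fin ℓ₂ ⊕ Fin ℓ₃ → Derivation F (Alg ℓ₁ Γ) (Alg ℓ₁ Γ)
  | Sum.inl i => dt Γ (Sum.inl i)
  | Sum.inr (Sum.inl j) => dstar ℓ₁ Γ (Sum.inl j) + dt Γ (Sum.inr j)
  | Sum.inr (Sum.inr l) => dstar ℓ₁ Γ (Sum.inr l)

/-- The space `𝒟 = ∑ 𝔽 ∂ᵢ`. -/
def derSpace (ℓ₁ : ℕ) (Γ : AddSubgroup (Row F ℓ₂ ℓ₃)) :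
    Submodule F (Derivation F (Alg ℓ₁ Γ) (Alg ℓ₁ Γ)) :=
  Submodule.span F (Set.range (del ℓ₁ Γ))

theorem der_ext {d e : Derivation F (Alg ℓ₁ Γ) (Alg ℓ₁ Γ)}
    (h : ∀ (α : Γ) ζ, d (mono α ζ) = e (mono α ζ)) :
    d = e := by
  ext1 u
  induction u using mono_induction with
  | zero => simp
  | add f g hf hg => rw [map_add, map_add, hf, hg]
  | mono α ζ => exact h α ζ

theorem pderiv_comm {σ : Type*} (i j : σ) (p : MvPolynomial σ F) :
    MvPolynomial.pderiv i (MvPolynomial.pderiv j p) =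
      MvPolynomial.pderiv j (MvPolynomial.pderiv i p) := by
  classical
  have h : ⁅(MvPolynomial.pderiv i : Derivation F (MvPolynomial σ F) (MvPolynomial σ F)),
      (MvPolynomial.pderiv j : Derivation F (MvPolynomial σ F) (MvPolynomial σ F))⁆ = 0 := by
    apply MvPolynomial.derivation_ext
    intro k
    simp only [Derivation.commutator_apply, MvPolynomial.pderiv_X, Pi.single_apply]
    split_ifs <;> simp
  have h2 := congrArg (fun d => d p) h
  simpa [Derivation.commutator_apply, sub_eq_zero] using h2

theorem dt_dt (i j : Fin ℓ₁ ⊕ Fin ℓ₂) : ⁅dt Γ i, dt Γ j⁆ = 0 := by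
  apply der_ext
  intro α ζ
  simp [Derivation.commutator_apply, dt_mono, pderiv_comm i j]

theorem dstar_dstar (i j : Fin ℓ₂ ⊕ Fin ℓ₃) : ⁅dstar ℓ₁ Γ i, dstar ℓ₁ Γ j⁆ = 0 := by
  apply der_ext
  intro α ζ
  rw [Derivation.commutator_apply, dstar_mono, dstar_mono, dstar_mono, dstar_mono,
    smul_comm]
  simp

theorem dstar_dt (i : Fin ℓ₂ ⊕ Fin ℓ₃) (j : Fin ℓ₁ ⊕ Fin ℓ₂) : ⁅dstar ℓ₁ Γ i, dt Γ j⁆ = 0 := by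
  apply der_ext
  intro α ζ
  rw [Derivation.commutator_apply, dstar_mono, dt_mono, dstar_mono, dt_mono,
    Derivation.map_smul]
  simp

theorem dt_dstar (i : Fin ℓ₂ ⊕ Fin ℓ₃) (j : Fin ℓ₁ ⊕ Fin ℓ₂) : ⁅dt Γ j, dstar ℓ₁ Γ i⁆ = 0 := by
  rw [← lie_skew, dstar_dt, neg_zero]

theorem del_comm (i j : Fin ℓ₁ ⊕ Fin ℓ₂ ⊕ Fin ℓ₃) : ⁅del ℓ₁ Γ i, del ℓ₁ Γ j⁆ = 0 := by
  rcases i with i | i | i <;> rcases j with j | j | j <;>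
    simp [del, dt_dt, dstar_dstar, dstar_dt, dt_dstar]

theorem derSpace_comm (d : Derivation F (Alg ℓ₁ Γ) (Alg ℓ₁ Γ)) (hd : d ∈ derSpace ℓ₁ Γ)
    (e : Derivation F (Alg ℓ₁ Γ) (Alg ℓ₁ Γ)) (he : e ∈ derSpace ℓ₁ Γ) : ⁅d, e⁆ = 0 := by
  induction he using Submodule.span_induction with
  | zero => simp
  | add y z _ _ h1 h2 => rw [lie_add, h1, h2, add_zero]
  | smul a y _ h => rw [lie_smul, h, smul_zero]
  | mem e he =>
    obtain ⟨j, rfl⟩ := he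
    induction hd using Submodule.span_induction with
    | zero => simp
    | add y z _ _ h1 h2 => rw [add_lie, h1, h2, add_zero]
    | smul a y _ h => rw [smul_lie, h, smul_zero]
    | mem d hd =>
      obtain ⟨i, rfl⟩ := hd
      exact del_comm i j

end Derivations

/-- The generalized Lie algebra of Witt type `𝒲(ℓ₁,ℓ₂,ℓ₃;Γ) = 𝒜(ℓ₁,ℓ₂,ℓ₃;Γ)𝒟`. -/
def W (ℓ₁ : ℕ) {ℓ₂ ℓ₃ : ℕ} (Γ : Omega F ℓ₂ ℓ₃) :
    LieSubalgebra F (Derivation F (Alg ℓ₁ Γ.1) (Alg ℓ₁ Γ.1)) :=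
  lieOf (derSpace ℓ₁ Γ.1) derSpace_comm

/-- The group `G_{ℓ₂,ℓ₃}` of block lower triangular matrices with invertible diagonal blocks
`A ∈ GL_{ℓ₂}`, `C ∈ GL_{ℓ₃}` and arbitrary lower left block `B` (of size `ℓ₃ × ℓ₂`). -/
def G (F : Type*) [Field F] (ℓ₂ ℓ₃ : ℕ) : Subgroup (GL (Fin ℓ₂ ⊕ Fin ℓ₃) F) where
  carrier := {g | ∃ (A : GL (Fin ℓ₂) F) (B : Matrix (Fin ℓ₃) (Fin ℓ₂) F) (C : GL (Fin ℓ₃) F),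
    (g : Matrix (Fin ℓ₂ ⊕ Fin ℓ₃) (Fin ℓ₂ ⊕ Fin ℓ₃) F) =
      Matrix.fromBlocks (A : Matrix (Fin ℓ₂) (Fin ℓ₂) F) 0 B (C : Matrix (Fin ℓ₃) (Fin ℓ₃) F)}
  one_mem' := ⟨1, 0, 1, by simp⟩
  mul_mem' := by
    rintro g h ⟨A, B, C, hg⟩ ⟨A', B', C', hh⟩
    exact ⟨A * A', B * A'.1 + C.1 * B', C * C', by simp [hg, hh, Matrix.fromBlocks_multiply]⟩
  inv_mem' := by
    rintro g ⟨A, B, C, hg⟩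
    refine ⟨A⁻¹, -((C⁻¹).1 * B * (A⁻¹).1), C⁻¹, ?_⟩
    rw [← Units.mul_eq_one_iff_inv_eq, hg, Matrix.fromBlocks_multiply]
    simp only [Matrix.mul_neg, ← Matrix.mul_assoc, ← Units.val_mul, mul_inv_cancel]
    simp

/-- The action `g(α) = α g⁻¹` on row vectors. -/
def rowAct {ℓ₂ ℓ₃ : ℕ} (g : G F ℓ₂ ℓ₃) : Row F ℓ₂ ℓ₃ →ₗ[F] Row F ℓ₂ ℓ₃ :=
  Matrix.vecMulLinear (((g⁻¹ : G F ℓ₂ ℓ₃) : GL (Fin ℓ₂ ⊕ Fin ℓ₃) F) :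
    Matrix (Fin ℓ₂ ⊕ Fin ℓ₃) (Fin ℓ₂ ⊕ Fin ℓ₃) F)

theorem rowAct_one {ℓ₂ ℓ₃ : ℕ} : rowAct (1 : G F ℓ₂ ℓ₃) = LinearMap.id := by
  apply LinearMap.ext; intro v; simp [rowAct]

theorem rowAct_mul {ℓ₂ ℓ₃ : ℕ} (g h : G F ℓ₂ ℓ₃) : rowAct (g * h) = rowAct g ∘ₗ rowAct h := by
  apply LinearMap.ext
  intro v
  simp only [rowAct, _root_.mul_inv_rev, Subgroup.coe_mul, Units.val_mul, LinearMap.comp_apply,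
    Matrix.vecMulLinear_apply, Matrix.vecMul_vecMul]

/-- The subgroup `g(Γ) = {g(α) | α ∈ Γ}`. -/
def imageSubgroup {ℓ₂ ℓ₃ : ℕ} (g : G F ℓ₂ ℓ₃) (Γ : AddSubgroup (Row F ℓ₂ ℓ₃)) :
    AddSubgroup (Row F ℓ₂ ℓ₃) :=
  Γ.map (rowAct g).toAddMonoidHom

theorem imageSubgroup_nondegenerate {ℓ₂ ℓ₃ : ℕ} (g : G F ℓ₂ ℓ₃)
    {Γ : AddSubgroup (Row F ℓ₂ ℓ₃)} (h : IsNondegenerate Γ) :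
    IsNondegenerate (imageSubgroup g Γ) := by
  obtain ⟨b, hb⟩ := h
  refine ⟨b.map (LinearEquiv.ofLinearMap (rowAct g) (rowAct g⁻¹) ?_ ?_), fun i => ?_⟩
  · rw [← rowAct_mul, mul_inv_cancel, rowAct_one]
  · rw [← rowAct_mul, inv_mul_cancel, rowAct_one]
  · exact ⟨b i, hb i, rfl⟩

/-- The action of `G_{ℓ₂,ℓ₃}` on `Ω_{ℓ₂+ℓ₃}`, `Γ ↦ g(Γ)`. -/
instance instMulActionOmega (ℓ₂ ℓ₃ : ℕ) : MulAction (G F ℓ₂ ℓ₃) (Omega F ℓ₂ ℓ₃) where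
  smul g Γ := ⟨imageSubgroup g Γ.1, imageSubgroup_nondegenerate g Γ.2⟩
  one_smul Γ := by
    apply Subtype.ext
    ext x
    change x ∈ Γ.1.map _ ↔ _
    simp [rowAct_one]
  mul_smul g h Γ := by
    apply Subtype.ext
    ext x
    change x ∈ Γ.1.map _ ↔ x ∈ (Γ.1.map _).map _
    simp [rowAct_mul]

/-- The moduli space `ℳ_{ℓ₂,ℓ₃} = Ω_{ℓ₂+ℓ₃} / G_{ℓ₂,ℓ₃}` of orbits. -/
abbrev Moduli (F : Type*) [Field F] (ℓ₂ ℓ₃ : ℕ) : Type _ :=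
  MulAction.orbitRel.Quotient (G F ℓ₂ ℓ₃) (Omega F ℓ₂ ℓ₃)

/-- The identification of `𝔽^{ℓ₂+ℓ₃}` with `𝔽^{ℓ₂'+ℓ₃'}` when `ℓ₂ = ℓ₂'` and `ℓ₃ = ℓ₃'`
(coordinate by coordinate). -/
def rowCast {ℓ₂ ℓ₃ ℓ₂' ℓ₃' : ℕ} (h₂ : ℓ₂ = ℓ₂') (h₃ : ℓ₃ = ℓ₃') :
    Row F ℓ₂ ℓ₃ →ₗ[F] Row F ℓ₂' ℓ₃' :=
  LinearMap.funLeft F F (Sum.map (Fin.cast h₂.symm) (Fin.cast h₃.symm))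

/-- The data `(ℓ₁,ℓ₂,ℓ₃;Γ)` with `ℓ₁ + ℓ₂ + ℓ₃ > 0` and `Γ` nondegenerate that define a Lie
algebra `𝒲(ℓ₁,ℓ₂,ℓ₃;Γ)`. -/
structure Datum (F : Type*) [Field F] where
  ℓ₁ : ℕ
  ℓ₂ : ℕ
  ℓ₃ : ℕ
  pos : 0 < ℓ₁ + ℓ₂ + ℓ₃
  Γ : Omega F ℓ₂ ℓ₃

/-- Isomorphism of the Lie algebras `𝒲(ℓ₁,ℓ₂,ℓ₃;Γ)`. -/
def isoSetoid (F : Type*) [Field F] : Setoid (Datum F) where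
  r d d' := Nonempty (W d.ℓ₁ d.Γ ≃ₗ⁅F⁆ W d'.ℓ₁ d'.Γ)
  iseqv := ⟨fun _ => ⟨LieEquiv.refl⟩, fun ⟨e⟩ => ⟨e.symm⟩, fun ⟨e⟩ ⟨f⟩ => ⟨e.trans f⟩⟩

/-- The set of isomorphism classes of the Lie algebras `𝒲(ℓ₁,ℓ₂,ℓ₃;Γ)`. -/
abbrev IsoClass (F : Type*) [Field F] : Type _ := Quotient (isoSetoid F)

/-- The set `SW` of all `(ℓ₁,ℓ₂,ℓ₃,ϖ)` with `(ℓ₁,ℓ₂,ℓ₃) ≠ (0,0,0)` and `ϖ ∈ ℳ_{ℓ₂,ℓ₃}`. -/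
abbrev SW (F : Type*) [Field F] : Type _ :=
  Σ l : {l : ℕ × ℕ × ℕ // l ≠ (0, 0, 0)}, Moduli F l.1.2.1 l.1.2.2

theorem triple_ne_zero {ℓ₁ ℓ₂ ℓ₃ : ℕ} (h : 0 < ℓ₁ + ℓ₂ + ℓ₃) :
    (ℓ₁, ℓ₂, ℓ₃) ≠ (0, 0, 0) := by
  intro h'
  simp only [Prod.mk.injEq] at h'
  omega

/-- The element `(ℓ₁,ℓ₂,ℓ₃,[Γ])` of `SW`, where `[Γ]` is the orbit of `Γ`. -/
def Datum.toSW (d : Datum F) : SW F :=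
  ⟨⟨(d.ℓ₁, d.ℓ₂, d.ℓ₃), triple_ne_zero d.pos⟩, Quotient.mk _ d.Γ⟩

end WittType

end

/-! The isomorphism of Lie algebras is first lifted to an isomorphism of the underlying commutative
algebras; the invariants are then read off from the units of the algebra and the way the derivations
act on them.

Lifting. Let `W` be a Lie algebra of derivations spanned over `A` by finitely many derivations, each
taking a unit value, with the `F`-points of `A` separating its elements. If `L` is a proper
subalgebra of finite codimension, then the functions `f` with `f • W ⊆ L` form a proper ideal, and
an identity between double brackets shows that this ideal has finite codimension. It is stable under
`L` and has a zero `p`, and in characteristic 0 a derivation stabilizing such an ideal vanishes at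
`p`. So the maximal proper subalgebras of finite codimension are exactly the stabilizers
`vanishingAt W p` of points. A Lie isomorphism `Φ` therefore matches points, and since points
separate elements this gives an algebra isomorphism `σ` with `Φ X = σ X σ⁻¹`
(`IsFrame.exists_algEquiv`).

Invariants. `Γ` is torsion free, so the units are exactly the elements `c x^α` with `c ≠ 0`, and `σ`
matches the lines `F x^α` with the lines `F x^β`. The constant derivations killing all `x^α` detect
`ℓ₁`. Derivations with all `x^α` as eigenvectors have constant coefficients at the last `ℓ₂ + ℓ₃`
basic derivations, which yields a matrix `M` with `Γ' M = Γ`. The derivations `∂*_{ℓ₂+l}` are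
diagonal and never take the value 1, whereas a nonzero coefficient at some `∂*_j + ∂_{t_{ℓ₁+j}}`
forces the value 1. Hence the upper right block of `M` is zero (`exists_matrix`). Rank inequalities
in both directions give equality of the triples.

Converse. A block triangular matrix acts on the exponents, and its upper left block acts on
`t_{ℓ₁+1}, …, t_{ℓ₁+ℓ₂}`; this algebra isomorphism carries the span of the `∂ᵢ` to itself
(`del_twistHom`). -/

noncomputable section

namespace WittType

/-! ### Subalgebras of finite codimension. -/

section LieCore

variable {F 𝔤 : Type*} [Field F] [LieRing 𝔤] [LieAlgebra F 𝔤]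

/-- The elements of a Lie subalgebra `L` that map the whole Lie algebra into `L`. -/
def lieCore (L : LieSubalgebra F 𝔤) : LieSubalgebra F 𝔤 where
  carrier := {x | x ∈ L ∧ ∀ y, ⁅x, y⁆ ∈ L}
  zero_mem' := ⟨zero_mem L, fun y => by simp⟩
  add_mem' := fun {a b} ha hb => ⟨add_mem ha.1 hb.1, fun y => by
    rw [add_lie]; exact add_mem (ha.2 y) (hb.2 y)⟩
  smul_mem' := fun c x hx => ⟨L.smul_mem c hx.1, fun y => by
    rw [smul_lie]; exact L.smul_mem c (hx.2 y)⟩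
  lie_mem' := fun {a b} ha hb => ⟨ha.2 b, fun y => by
    rw [lie_lie]
    exact sub_mem (ha.2 _) (hb.2 _)⟩

theorem comap_cofg {M N : Type*} [AddCommGroup M] [Module F M] [AddCommGroup N] [Module F N]
    (f : M →ₗ[F] N) {S : Submodule F N} (hS : S.CoFG) : (S.comap f).CoFG := by
  have : S.comap f = LinearMap.ker (S.mkQ ∘ₗ f) := by
    ext x; simp
  rw [this]
  have : Module.Finite F (N ⧸ S) := hS
  exact Submodule.CoFG.ker _

/-- Since `L` is closed under brackets, an `x ∈ L` maps everything into `L` once its brackets with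
finitely many representatives of a spanning set of `𝔤 / L` lie in `L`. These are finitely many
linear conditions with values in the finite-dimensional space `𝔤 / L`. -/
theorem lieCore_cofg {L : LieSubalgebra F 𝔤} (hL : L.toSubmodule.CoFG) :
    (lieCore L).toSubmodule.CoFG := by
  have : Module.Finite F (𝔤 ⧸ L.toSubmodule) := hL
  obtain ⟨n, s, hs⟩ := Module.Finite.exists_fin (R := F) (M := 𝔤 ⧸ L.toSubmodule)
  choose r hr using fun i => Submodule.mkQ_surjective L.toSubmodule (s i)
  let ψ : 𝔤 →ₗ[F] (Fin n → 𝔤 ⧸ L.toSubmodule) :=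
    LinearMap.pi fun i => L.toSubmodule.mkQ ∘ₗ (-(LieAlgebra.ad F 𝔤 (r i) : 𝔤 →ₗ[F] 𝔤))
  have h1 : (L.toSubmodule ⊓ LinearMap.ker ψ).CoFG := hL.inf (Submodule.CoFG.ker ψ)
  refine Submodule.CoFG.of_le ?_ h1
  rintro x ⟨hx, hx'⟩
  refine ⟨hx, fun y => ?_⟩
  have hxr : ∀ i, ⁅x, r i⁆ ∈ L := by
    intro i
    have := congrFun (LinearMap.mem_ker.1 hx') i
    have h2 : ⁅r i, x⁆ ∈ L := by simpa [ψ] using this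
    rw [← lie_skew]
    exact neg_mem h2
  have hy : L.toSubmodule.mkQ y ∈ Submodule.span F (Set.range s) := by rw [hs]; trivial
  obtain ⟨c, hc⟩ := (Submodule.mem_span_range_iff_exists_fun F).1 hy
  have h2 : y - ∑ i, c i • r i ∈ L := by
    rw [← LieSubalgebra.mem_toSubmodule, ← Submodule.ker_mkQ L.toSubmodule, LinearMap.mem_ker,
      map_sub, map_sum, ← hc]
    simp only [map_smul, hr, sub_self]
  have h3 : ⁅x, y⁆ = ⁅x, y - ∑ i, c i • r i⁆ + ∑ i, c i • ⁅x, r i⁆ := by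
    simp [lie_sum]
  rw [h3]
  exact add_mem (L.lie_mem hx h2) (sum_mem fun i _ => L.smul_mem _ (hxr i))

end LieCore

/-! ### Lie algebras of derivations: recovering the points and the algebra. -/

section Frame

variable {F A ι : Type*} [Field F] [CommRing A] [Algebra F A] [Fintype ι]

/-- A Lie algebra `W` of derivations of `A` is spanned over `A` by a finite family `δ` of
derivations each of which takes an invertible value, and the `F`-points of `A` separate its
elements. -/
structure IsFrame (W : LieSubalgebra F (Derivation F A A)) (δ : ι → Derivation F A A) :
    Prop where
  mem_iff : ∀ X, X ∈ W ↔ ∃ u : ι → A, X = ∑ i, u i • δ i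
  unit : ∀ i, ∃ m, IsUnit (δ i m)
  separates : ∀ a : A, (∀ p : A →ₐ[F] F, p a = 0) → a = 0

namespace IsFrame

variable {W : LieSubalgebra F (Derivation F A A)} {δ : ι → Derivation F A A} (h : IsFrame W δ)

include h

theorem smul_mem (f : A) {X : Derivation F A A} (hX : X ∈ W) : f • X ∈ W := by
  obtain ⟨u, rfl⟩ := (h.mem_iff X).1 hX
  exact (h.mem_iff _).2 ⟨fun i => f * u i, by simp [Finset.smul_sum, mul_smul]⟩

theorem mem (i : ι) : δ i ∈ W := by
  classical
  refine (h.mem_iff _).2 ⟨Pi.single i 1, ?_⟩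
  rw [Finset.sum_eq_single i] <;> simp +contextual

end IsFrame

/-- Elements of `Derivation F A A` in a Lie algebra of derivations closed under multiplication by
`A`, as an `F`-linear function of the coefficient. -/
def coeffSMul {W : LieSubalgebra F (Derivation F A A)} (hW : ∀ (f : A) (X), X ∈ W → f • X ∈ W)
    (X : W) : A →ₗ[F] W where
  toFun f := ⟨f • X.1, hW f X.1 X.2⟩
  map_add' f g := Subtype.ext (add_smul f g X.1)
  map_smul' c f := Subtype.ext (smul_assoc c f X.1)

theorem coe_coeffSMul {W : LieSubalgebra F (Derivation F A A)}
    (hW : ∀ (f : A) (X), X ∈ W → f • X ∈ W) (X : W) (f : A) :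
    (coeffSMul hW X f : Derivation F A A) = f • X.1 := rfl

/-- Moving `m` and `k` between the two outer slots and taking a second difference cancels every term
that differentiates `f`, `g` or `h`. The result is `A`-linear in `f`, so membership can be passed
from `f • X` to its multiples. -/
theorem differentiator (X : Derivation F A A) (f g h m k : A) :
    ((⁅⁅f • X, (g * m * k) • X⁆, h • X⁆ - ⁅⁅f • X, (g * m) • X⁆, (h * k) • X⁆)
      - (⁅⁅f • X, (g * k) • X⁆, (h * m) • X⁆ - ⁅⁅f • X, g • X⁆, (h * m * k) • X⁆))
      = (-4 * (f * g * h * X m * X k)) • X := by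
  ext a
  simp only [Derivation.commutator_apply, Derivation.smul_apply, Derivation.sub_apply,
    smul_eq_mul, Derivation.leibniz, map_sub, map_add]
  ring

variable [CharZero F]

/-- Double brackets starting from an element of the second core stay in `L`; `differentiator` turns
them into arbitrary multiples of `f • X`. -/
theorem smul_mem_of_mem_lieCore {W : LieSubalgebra F (Derivation F A A)}
    (hW : ∀ (f : A) (X), X ∈ W → f • X ∈ W) (L : LieSubalgebra F W) (X : W) {m : A}
    (hm : IsUnit (X.1 m)) {f : A} (hf : coeffSMul hW X f ∈ lieCore (lieCore L)) (g : A) :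
    coeffSMul hW X (f * g) ∈ L := by
  have key : ∀ a b : A, ⁅⁅coeffSMul hW X f, coeffSMul hW X a⁆, coeffSMul hW X b⁆ ∈ L :=
    fun a b => (hf.2 _).2 _
  obtain ⟨v, hv⟩ := hm.exists_right_inv
  -- The case `h = 1`, `k = m` of `differentiator`, with `g` replaced by `g v²`, where `v` is the
  -- inverse of `X m`, so that the factor `(X m)²` is cancelled.
  have h1 := sub_mem (sub_mem (key (g * v * v * m * m) 1) (key (g * v * v * m) m))
    (sub_mem (key (g * v * v * m) m) (key (g * v * v) (m * m)))
  have h2 := L.smul_mem (-4⁻¹ : F) h1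
  convert h2 using 1
  apply Subtype.ext
  have := differentiator X.1 f (g * v * v) 1 m m
  simp only [one_mul] at this
  change (f * g) • X.1 = (-4⁻¹ : F) • (_ - _ - (_ - _) : Derivation F A A)
  simp only [LieSubalgebra.coe_bracket, coe_coeffSMul]
  rw [this]
  have h4 : (4 : F) ≠ 0 := by norm_num
  have h3 : f * (g * v * v) * 1 * X.1 m * X.1 m = f * g := by
    linear_combination (f * g * v * X.1 m + f * g) * hv
  rw [h3, ← smul_assoc]
  congr 1
  rw [Algebra.smul_def]
  have h5 : (4 : A) = algebraMap F A 4 := (map_ofNat _ 4).symm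
  rw [h5, ← map_neg, ← mul_assoc, ← map_mul]
  simp [h4]

variable [IsAlgClosed F]

-- The residue field at a maximal ideal above `I` is finite over the algebraically closed field `F`,
-- hence equal to `F`.
omit [CharZero F] in
theorem exists_point_of_ideal_cofg {I : Ideal A} (hI : I ≠ ⊤)
    (hfin : (I.restrictScalars F).CoFG) : ∃ p : A →ₐ[F] F, ∀ a ∈ I, p a = 0 := by
  obtain ⟨M, hM, hIM⟩ := Ideal.exists_le_maximal I hI
  have hMfin : (M.restrictScalars F).CoFG := hfin.of_le hIM
  have : Module.Finite F (A ⧸ M) := hMfin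
  let _ : Field (A ⧸ M) := Ideal.Quotient.field M
  have hb := IsAlgClosed.algebraMap_bijective_of_isIntegral (k := F) (K := A ⧸ M)
  let e : F ≃ₐ[F] (A ⧸ M) := AlgEquiv.ofBijective (Algebra.ofId F (A ⧸ M)) hb
  refine ⟨e.symm.toAlgHom.comp (Ideal.Quotient.mkₐ F M), fun a ha => ?_⟩
  have : Ideal.Quotient.mkₐ F M a = 0 := Ideal.Quotient.eq_zero_iff_mem.2 (hIM ha)
  change e.symm (Ideal.Quotient.mkₐ F M a) = 0
  rw [this, map_zero]

omit [IsAlgClosed F] in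
/-- A derivation that stabilizes an ideal of finite codimension vanishes at all points of it. -/
theorem point_derivation_eq_zero {I : Ideal A} (hfin : (I.restrictScalars F).CoFG)
    {p : A →ₐ[F] F} (hp : ∀ a ∈ I, p a = 0) {X : Derivation F A A} (hX : ∀ a ∈ I, X a ∈ I)
    (a : A) : p (X a) = 0 := by
  set b := a - algebraMap F A (p a) with hb
  have hXb : X b = X a := by simp [hb]
  -- Modulo `I` the element `b` is a root of a monic `μ = T^m q` with `q(0) ≠ 0`. Take `c = q(b)`;
  -- as `p b = 0`, its value at `p` is `q(0)`.
  have hex : ∃ m : ℕ, ∃ c, p c ≠ 0 ∧ b ^ m * c ∈ I := by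
    have : Module.Finite F (A ⧸ I) := hfin
    have hint : IsIntegral F (Ideal.Quotient.mkₐ F I b) := Algebra.IsIntegral.isIntegral _
    obtain ⟨μ, hμ, hμ0⟩ := hint
    obtain ⟨q, hq, hdvd⟩ := μ.exists_eq_pow_rootMultiplicity_mul_and_not_dvd hμ.ne_zero 0
    refine ⟨μ.rootMultiplicity 0, Polynomial.aeval b q, ?_, ?_⟩
    · have hpb : p b = 0 := by simp [hb]
      rw [← Polynomial.aeval_algHom_apply, hpb, Polynomial.coe_aeval_eq_eval]
      rwa [Polynomial.dvd_iff_isRoot] at hdvd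
    · rw [← Polynomial.aeval_def, Polynomial.aeval_algHom_apply] at hμ0
      have h1 := Ideal.Quotient.eq_zero_iff_mem.1 hμ0
      generalize μ.rootMultiplicity 0 = n at hq
      rw [hq] at h1
      simpa using h1
  classical
  obtain ⟨c, hc, hcI⟩ := Nat.find_spec hex
  have hmin := fun n (hn : n < Nat.find hex) => Nat.find_min hex hn
  generalize Nat.find hex = m at hcI hmin
  by_contra hne
  rcases m with _ | m
  · exact hc (hp c (by simpa using hcI))
  -- Differentiating `b^(m+1) c ∈ I` along `X` gives `(m+1) b^m X(b) c² ∈ I`, and `m+1` is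
  -- invertible. If `p (X b) ≠ 0`, this contradicts the minimality of the exponent.
  · refine hmin m (Nat.lt_succ_self m) ⟨X b * c * c, ?_, ?_⟩
    · rw [map_mul, map_mul, hXb]; exact mul_ne_zero (mul_ne_zero hne hc) hc
    · have h1 := I.mul_mem_right c (hX _ hcI)
      have h2 := I.mul_mem_right (X c) hcI
      have h3 : ((m + 1 : ℕ) : A) * (b ^ m * (X b * c * c)) ∈ I := by
        have : ((m + 1 : ℕ) : A) * (b ^ m * (X b * c * c)) =
            X (b ^ (m + 1) * c) * c - b ^ (m + 1) * c * X c := by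
          simp only [Derivation.leibniz, Derivation.leibniz_pow, smul_eq_mul, nsmul_eq_mul,
            Nat.add_sub_cancel]
          ring
        rw [this]; exact sub_mem h1 h2
      have h4 := I.mul_mem_left (algebraMap F A ((m + 1 : ℕ) : F)⁻¹) h3
      rwa [← mul_assoc, ← map_natCast (algebraMap F A), ← map_mul,
        inv_mul_cancel₀ (Nat.cast_ne_zero.2 (Nat.succ_ne_zero m)), map_one, one_mul] at h4

/-- The subalgebra of the derivations in `W` that vanish at the point `p`. -/
def vanishingAt (W : LieSubalgebra F (Derivation F A A)) (p : A →ₐ[F] F) : LieSubalgebra F W where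
  carrier := {X | ∀ a, p (X.1 a) = 0}
  zero_mem' := fun a => by simp
  add_mem' := fun {X Y} hX hY a => by simp [hX a, hY a]
  smul_mem' := fun c X hX a => by simp [hX a]
  lie_mem' := fun {X Y} hX hY a => by
    simp [Derivation.commutator_apply, hX (Y.1 a), hY (X.1 a)]

namespace IsFrame

variable {W : LieSubalgebra F (Derivation F A A)} {δ : ι → Derivation F A A} (h : IsFrame W δ)

include h

-- Replacing each coefficient by its value at `p` changes a derivation by one that vanishes at `p`,
-- so the constant combinations of the frame supplement this subalgebra.
omit [CharZero F] [IsAlgClosed F] in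
theorem vanishingAt_cofg (p : A →ₐ[F] F) : (vanishingAt W p).toSubmodule.CoFG := by
  let d : ι → W := fun i => ⟨δ i, h.mem i⟩
  refine Submodule.FG.cofg_of_codisjoint (S := Submodule.span F (Set.range d)) ?_
    (Submodule.fg_span (Set.finite_range d))
  rw [codisjoint_iff, eq_top_iff]
  rintro X -
  obtain ⟨u, hu⟩ := (h.mem_iff X.1).1 X.2
  have h1 : ∑ i, p (u i) • d i ∈ Submodule.span F (Set.range d) :=
    sum_mem fun i _ => Submodule.smul_mem _ _ (Submodule.subset_span ⟨i, rfl⟩)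
  have h2 : X - ∑ i, p (u i) • d i ∈ (vanishingAt W p).toSubmodule := by
    intro a
    have : (X - ∑ i, p (u i) • d i).1 = ∑ i, u i • δ i - ∑ i, p (u i) • δ i := by
      rw [← hu]; simp [d]
    rw [this, Derivation.sub_apply, ← Derivation.coeFnAddMonoidHom_apply,
      ← Derivation.coeFnAddMonoidHom_apply, map_sum, map_sum]
    simp
  have := Submodule.add_mem_sup h1 h2
  simpa using this

omit [CharZero F] [IsAlgClosed F] in
theorem vanishingAt_ne_top [Nonempty ι] (p : A →ₐ[F] F) : vanishingAt W p ≠ ⊤ := by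
  intro htop
  obtain ⟨i⟩ := ‹Nonempty ι›
  obtain ⟨m, hm⟩ := h.unit i
  have : (⟨δ i, h.mem i⟩ : W) ∈ vanishingAt W p := by rw [htop]; trivial
  exact (hm.map p).ne_zero (this m)

-- The derivation `(a - p a) • δ i` vanishes at `p`, hence at `q`; since `δ i` has a unit value, `q
-- a = p a`.
omit [CharZero F] [IsAlgClosed F] in
theorem point_eq_of_vanishingAt_le [Nonempty ι] {p q : A →ₐ[F] F}
    (hpq : vanishingAt W p ≤ vanishingAt W q) : p = q := by
  obtain ⟨i⟩ := ‹Nonempty ι›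
  obtain ⟨m, hm⟩ := h.unit i
  ext a
  have h1 : (⟨(a - algebraMap F A (p a)) • δ i, h.smul_mem _ (h.mem i)⟩ : W) ∈ vanishingAt W p := by
    intro b
    simp
  have h2 := hpq h1 m
  simp only [Derivation.smul_apply, smul_eq_mul, map_mul, map_sub, AlgHom.commutes] at h2
  rcases mul_eq_zero.1 h2 with h3 | h3
  · exact (sub_eq_zero.1 h3).symm
  · exact absurd h3 (hm.map q).ne_zero

/-- Every proper subalgebra of finite codimension vanishes at some point. -/
theorem exists_le_vanishingAt {L : LieSubalgebra F W} (hL : L.toSubmodule.CoFG) (hne : L ≠ ⊤) :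
    ∃ p : A →ₐ[F] F, L ≤ vanishingAt W p := by
  let d : ι → W := fun i => ⟨δ i, h.mem i⟩
  let sm := fun X : W => coeffSMul (fun f _ => h.smul_mem f) X
  -- The functions `f` with `f • W ⊆ L`, stated with an extra factor `g` so that closure under
  -- multiplication is immediate.
  let I : Ideal A :=
    { carrier := {f | ∀ X g, sm X (f * g) ∈ L}
      zero_mem' := fun X g => by rw [zero_mul, map_zero]; exact zero_mem L
      add_mem' := fun {a b} ha hb X g => by
        rw [add_mul, map_add]; exact add_mem (ha X g) (hb X g)
      smul_mem' := fun c f hf X g => by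
        rw [smul_eq_mul, mul_comm c f, mul_assoc]; exact hf X _ }
  have hN : (lieCore (lieCore L)).toSubmodule.CoFG := lieCore_cofg (lieCore_cofg hL)
  have hIfin : (I.restrictScalars F).CoFG := by
    -- The kernel of `ψ` consists of the `f` for which all `f • δ i` lie in the second core. It has
    -- finite codimension and is contained in `I`.
    let ψ : A →ₗ[F] (ι → W ⧸ (lieCore (lieCore L)).toSubmodule) :=
      LinearMap.pi fun i => (lieCore (lieCore L)).toSubmodule.mkQ ∘ₗ sm (d i)
    have := hN
    refine Submodule.CoFG.of_le ?_ (Submodule.CoFG.ker ψ)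
    intro f hf X g
    obtain ⟨u, hu⟩ := (h.mem_iff X.1).1 X.2
    have h1 : sm X (f * g) = ∑ i, sm (d i) (f * (g * u i)) := by
      apply Subtype.ext
      simp only [sm, coe_coeffSMul, AddSubmonoidClass.coe_finsetSum, hu, Finset.smul_sum, d,
        smul_smul, mul_assoc]
    rw [h1]
    refine sum_mem fun i _ => ?_
    obtain ⟨m, hm⟩ := h.unit i
    refine smul_mem_of_mem_lieCore _ L (d i) hm ?_ _
    have := congrFun (LinearMap.mem_ker.1 hf) i
    simpa [ψ] using this
  have hIne : I ≠ ⊤ := by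
    intro hI
    apply hne
    rw [eq_top_iff]
    rintro X -
    have h1 : (1 : A) ∈ I := by rw [hI]; trivial
    have h2 := h1 X 1
    have h3 : sm X (1 * 1) = X := Subtype.ext (by simp [sm, coe_coeffSMul])
    rwa [h3] at h2
  obtain ⟨p, hp⟩ := exists_point_of_ideal_cofg hIne hIfin
  refine ⟨p, fun X hX a => point_derivation_eq_zero hIfin hp (fun f hf Y g => ?_) a⟩
  -- The Leibniz rule shows that `I` is stable under every `X ∈ L`.
  have h1 : sm Y (X.1 f * g) = ⁅X, sm Y (f * g)⁆ - sm Y (f * X.1 g) - sm ⁅X, Y⁆ (f * g) := by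
    apply Subtype.ext
    apply Derivation.ext
    intro b
    simp only [sm, coe_coeffSMul, AddSubgroupClass.coe_sub, LieSubalgebra.coe_bracket,
      Derivation.sub_apply, Derivation.commutator_apply, Derivation.smul_apply, smul_eq_mul,
      Derivation.leibniz]
    ring
  rw [h1]
  exact sub_mem (sub_mem (L.lie_mem hX (hf Y g)) (hf Y _)) (hf _ g)

variable {A' ι' : Type*} [CommRing A'] [Algebra F A'] [Fintype ι'] [Nonempty ι] [Nonempty ι']
  {W' : LieSubalgebra F (Derivation F A' A')} {δ' : ι' → Derivation F A' A'} (h' : IsFrame W' δ')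

include h'

/-- The preimage of the stabilizer of `q` lies in the stabilizer of some `p`, whose image lies in
the stabilizer of some `q'`. No stabilizer contains that of a different point, so `q' = q` and both
inclusions are equalities. -/
theorem exists_point_iff (Φ : W ≃ₗ⁅F⁆ W') (q : A' →ₐ[F] F) :
    ∃ p : A →ₐ[F] F, ∀ X : W, X ∈ vanishingAt W p ↔ Φ X ∈ vanishingAt W' q := by
  have h1 : ((vanishingAt W' q).comap Φ.toLieHom).toSubmodule.CoFG :=
    comap_cofg (Φ : W →ₗ[F] W') (h'.vanishingAt_cofg q)
  have h2 : (vanishingAt W' q).comap Φ.toLieHom ≠ ⊤ := by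
    intro htop
    apply h'.vanishingAt_ne_top q
    rw [eq_top_iff]
    rintro Y -
    have : Φ.symm Y ∈ (vanishingAt W' q).comap Φ.toLieHom := by rw [htop]; trivial
    rw [LieSubalgebra.mem_comap] at this
    simpa using this
  obtain ⟨p, hp⟩ := h.exists_le_vanishingAt h1 h2
  have h3 : ((vanishingAt W p).comap Φ.symm.toLieHom).toSubmodule.CoFG :=
    comap_cofg (Φ.symm : W' →ₗ[F] W) (h.vanishingAt_cofg p)
  have h4 : (vanishingAt W p).comap Φ.symm.toLieHom ≠ ⊤ := by
    intro htop
    apply h.vanishingAt_ne_top p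
    rw [eq_top_iff]
    rintro Y -
    have : Φ Y ∈ (vanishingAt W p).comap Φ.symm.toLieHom := by rw [htop]; trivial
    rw [LieSubalgebra.mem_comap] at this
    simpa using this
  obtain ⟨q', hq'⟩ := h'.exists_le_vanishingAt h3 h4
  have h5 : q = q' := by
    refine h'.point_eq_of_vanishingAt_le fun Y hY => hq' ?_
    rw [LieSubalgebra.mem_comap]
    refine hp ?_
    rw [LieSubalgebra.mem_comap]
    simpa using hY
  subst h5
  refine ⟨p, fun X => ⟨fun hX => hq' ?_, fun hX => hp hX⟩⟩
  rw [LieSubalgebra.mem_comap]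
  simpa using hX

/-- `f • X - p(f) X` vanishes at `p`. Hence, at `q`, `Φ (f • X)` agrees with `p(f) Φ X` for the
point `p` matched with `q`. The function `q ↦ p(f)` is thus represented by an element of `A'`. -/
theorem exists_algHom (Φ : W ≃ₗ⁅F⁆ W') :
    ∃ σ : A →ₐ[F] A', ∀ (f : A) (X Y : W), Y.1 = f • X.1 → (Φ Y).1 = σ f • (Φ X).1 := by
  choose pt hpt using h.exists_point_iff h' Φ
  obtain ⟨j⟩ := ‹Nonempty ι'›
  obtain ⟨m, hm⟩ := h'.unit j
  obtain ⟨v, hv⟩ := hm.exists_left_inv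
  set X₀ : W := Φ.symm ⟨δ' j, h'.mem j⟩ with hX₀
  have hΦX₀ : (Φ X₀).1 = δ' j := by simp [hX₀]
  have key : ∀ (q : A' →ₐ[F] F) (f : A) (X Y : W), Y.1 = f • X.1 →
      ∀ a, q ((Φ Y).1 a) = pt q f * q ((Φ X).1 a) := by
    intro q f X Y hY a
    have h1 : Y - pt q f • X ∈ vanishingAt W (pt q) := by
      intro b
      simp [hY]
    have h2 := (hpt q _).1 h1 a
    simpa [sub_eq_zero] using h2
  -- As `Φ X₀ = δ' j`, evaluating at `m` and dividing by the unit `δ' j m` isolates the factor by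
  -- which `f` acts.
  let τ : A → A' := fun f => v * (Φ ⟨f • X₀.1, h.smul_mem f X₀.2⟩).1 m
  have hτ : ∀ q f, q (τ f) = pt q f := by
    intro q f
    simp only [τ, map_mul]
    rw [key q f X₀ _ rfl m, hΦX₀]
    have : q v * q (δ' j m) = 1 := by rw [← map_mul, hv, map_one]
    linear_combination (pt q f) * this
  have hsep : ∀ a b : A', (∀ q : A' →ₐ[F] F, q a = q b) → a = b := by
    intro a b hab
    exact sub_eq_zero.1 (h'.separates _ fun q => by rw [map_sub, hab, sub_self])
  refine ⟨{ toFun := τ, map_one' := ?_, map_mul' := ?_, map_zero' := ?_, map_add' := ?_,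
            commutes' := ?_ }, ?_⟩
  · exact hsep _ _ fun q => by simp [hτ]
  · exact fun a b => hsep _ _ fun q => by simp [hτ]
  · exact hsep _ _ fun q => by simp [hτ]
  · exact fun a b => hsep _ _ fun q => by simp [hτ]
  · exact fun a => hsep _ _ fun q => by simp [hτ]
  · intro f X Y hY
    ext a
    refine hsep _ _ fun q => ?_
    rw [key q f X Y hY a]
    change _ = q (τ f * _)
    rw [map_mul, hτ]
    rfl

/-- An isomorphism of Lie algebras of derivations is induced by an isomorphism of the algebras. -/
theorem exists_algEquiv (Φ : W ≃ₗ⁅F⁆ W') :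
    ∃ σ : A ≃ₐ[F] A', ∀ (X : W) (f : A), σ (X.1 f) = (Φ X).1 (σ f) := by
  obtain ⟨σ, hσ⟩ := h.exists_algHom h' Φ
  obtain ⟨τ, hτ⟩ := h'.exists_algHom h Φ.symm
  have left : ∀ f, τ (σ f) = f := by
    intro f
    obtain ⟨i⟩ := ‹Nonempty ι›
    obtain ⟨m, hm⟩ := h.unit i
    have h1 := hτ _ _ _ (hσ f ⟨δ i, h.mem i⟩ ⟨f • δ i, h.smul_mem f (h.mem i)⟩ rfl)
    simp only [LieEquiv.symm_apply_apply] at h1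
    have h2 := congrArg (fun D => D m) h1
    exact (hm.mul_right_cancel h2).symm
  have right : ∀ f, σ (τ f) = f := by
    intro f
    obtain ⟨i⟩ := ‹Nonempty ι'›
    obtain ⟨m, hm⟩ := h'.unit i
    have h1 := hσ _ _ _ (hτ f ⟨δ' i, h'.mem i⟩ ⟨f • δ' i, h'.smul_mem f (h'.mem i)⟩ rfl)
    simp only [LieEquiv.apply_symm_apply] at h1
    have h2 := congrArg (fun D => D m) h1
    exact (hm.mul_right_cancel h2).symm
  refine ⟨AlgEquiv.ofAlgHom σ τ (AlgHom.ext right) (AlgHom.ext left), fun X f => ?_⟩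
  change σ (X.1 f) = (Φ X).1 (σ f)
  obtain ⟨i⟩ := ‹Nonempty ι'›
  obtain ⟨m, hm⟩ := h'.unit i
  set Z : W := Φ.symm ⟨δ' i, h'.mem i⟩ with hZ
  have hΦZ : (Φ Z).1 = δ' i := by simp [hZ]
  let fZ : W := ⟨f • Z.1, h.smul_mem f Z.2⟩
  let P : W := ⟨X.1 f • Z.1, h.smul_mem _ Z.2⟩
  let Q : W := ⟨f • ⁅X, Z⁆.1, h.smul_mem _ ⁅X, Z⁆.2⟩
  -- The rule `[X, fZ] = X(f) Z + f [X, Z]`; applying `Φ`, evaluating at `m` and cancelling the unit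
  -- `δ' i m` leaves the intertwining relation.
  have h1 : ⁅X, fZ⁆ = P + Q := by
    apply Subtype.ext
    apply Derivation.ext
    intro b
    simp only [fZ, P, Q, AddMemClass.coe_add, LieSubalgebra.coe_bracket,
      Derivation.add_apply, Derivation.commutator_apply, Derivation.smul_apply, smul_eq_mul,
      Derivation.leibniz]
    ring
  have h2 := congrArg (fun D => (Φ D).1 m) h1
  simp only [LieEquiv.map_lie, map_add, AddMemClass.coe_add, LieSubalgebra.coe_bracket,
    Derivation.add_apply, Derivation.commutator_apply, hσ f Z fZ rfl, hσ (X.1 f) Z P rfl,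
    hσ f ⁅X, Z⁆ Q rfl, hΦZ, Derivation.smul_apply, smul_eq_mul, Derivation.leibniz] at h2
  apply hm.mul_right_cancel
  linear_combination -h2

end IsFrame

end Frame

variable {F : Type*} [Field F]

/-! ### Units and points of the algebra `𝒜`. -/

section Alg

variable {ℓ₁ ℓ₂ ℓ₃ : ℕ} {Γ : AddSubgroup (Row F ℓ₂ ℓ₃)}

theorem mono_zero_one : (mono 0 1 : Alg ℓ₁ Γ) = 1 := rfl

theorem mono_zero (α : Γ) : (mono α 0 : Alg ℓ₁ Γ) = 0 := AddMonoidAlgebra.single_zero α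

/-- The coefficients of an element with respect to the basis `x^α`. -/
def coeffs (a : Alg ℓ₁ Γ) : Γ →₀ MvPolynomial (Fin ℓ₁ ⊕ Fin ℓ₂) F :=
  AddMonoidAlgebra.coeff (R := MvPolynomial (Fin ℓ₁ ⊕ Fin ℓ₂) F) a

theorem coeffs_mono (α : Γ) (ζ : MvPolynomial (Fin ℓ₁ ⊕ Fin ℓ₂) F) :
    coeffs (mono α ζ) = Finsupp.single α ζ := rfl

theorem coeffs_injective : Function.Injective (coeffs (ℓ₁ := ℓ₁) (Γ := Γ)) :=
  AddMonoidAlgebra.coeff_injective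

theorem sum_mono_coeffs (a : Alg ℓ₁ Γ) : (coeffs a).sum mono = a :=
  AddMonoidAlgebra.sum_coeff_single (R := MvPolynomial (Fin ℓ₁ ⊕ Fin ℓ₂) F) a

theorem mono_inj {α β : Γ} {ζ η : MvPolynomial (Fin ℓ₁ ⊕ Fin ℓ₂) F} (hζ : ζ ≠ 0)
    (h : mono α ζ = mono β η) : α = β ∧ ζ = η := by
  have h1 := congrArg coeffs h
  rw [coeffs_mono, coeffs_mono, Finsupp.single_eq_single_iff] at h1
  rcases h1 with h1 | h1
  · exact h1
  · exact absurd h1.1 hζ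

theorem mono_eq_zero {α : Γ} {ζ : MvPolynomial (Fin ℓ₁ ⊕ Fin ℓ₂) F} :
    mono α ζ = 0 ↔ ζ = 0 := by
  refine ⟨fun h => by_contra fun hζ => ?_, fun h => by rw [h, mono_zero]⟩
  exact hζ (mono_inj (β := α) (η := 0) hζ (by rw [h, mono_zero])).2

theorem isUnit_mono_C (α : Γ) {c : F} (hc : c ≠ 0) :
    IsUnit (mono α (MvPolynomial.C c) : Alg ℓ₁ Γ) := by
  refine IsUnit.of_mul_eq_one (mono (-α) (MvPolynomial.C c⁻¹)) ?_
  rw [mono_mul_mono, add_neg_cancel, ← MvPolynomial.C_mul, mul_inv_cancel₀ hc, MvPolynomial.C_1,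
    mono_zero_one]

/-- In characteristic 0 the group `Γ` embeds in a vector space over `ℚ`. -/
instance instTwoUniqueSums [CharZero F] : TwoUniqueSums Γ :=
  letI : Module ℚ (Row F ℓ₂ ℓ₃) := Module.compHom _ (algebraMap ℚ F)
  TwoUniqueSums.of_injective_addHom (Γ.subtype : Γ →ₙ+ Row F ℓ₂ ℓ₃) Γ.subtype_injective
    inferInstance

/-- If `u v = 1`, a pair of exponents with a uniquely represented sum contributes a nonzero
coefficient, so its sum is 0. Two different such pairs would have the same sum, against uniqueness;
so `u` and `v` have one term each. -/
theorem eq_mono_of_isUnit [CharZero F] {u : Alg ℓ₁ Γ} (hu : IsUnit u) :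
    ∃ (α : Γ) (c : F), c ≠ 0 ∧ u = mono α (MvPolynomial.C c) := by
  obtain ⟨v, huv⟩ := hu.exists_right_inv
  have key : ∀ a b : Γ, a ∈ (coeffs u).support → b ∈ (coeffs v).support →
      UniqueAdd (coeffs u).support (coeffs v).support a b → a + b = 0 := by
    intro a b ha hb hab
    have h1 : coeffs (u * v) (a + b) = coeffs u a * coeffs v b :=
      AddMonoidAlgebra.coeff_mul_add_of_uniqueAdd hab
    rw [huv, ← mono_zero_one, coeffs_mono] at h1
    by_contra hne
    rw [Finsupp.single_eq_of_ne hne] at h1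
    exact mul_ne_zero (Finsupp.mem_support_iff.1 ha) (Finsupp.mem_support_iff.1 hb) h1.symm
  have hu0 : u ≠ 0 := by
    rintro rfl
    rw [zero_mul] at huv
    exact one_ne_zero (mono_eq_zero.1 (mono_zero_one.trans huv.symm))
  have hv0 : v ≠ 0 := by
    rintro rfl
    rw [mul_zero] at huv
    exact one_ne_zero (mono_eq_zero.1 (mono_zero_one.trans huv.symm))
  have hcu : (coeffs u).support.Nonempty := Finsupp.support_nonempty_iff.2 fun h0 =>
    hu0 (coeffs_injective h0)
  have hcv : (coeffs v).support.Nonempty := Finsupp.support_nonempty_iff.2 fun h0 =>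
    hv0 (coeffs_injective h0)
  have hcard : ¬ 1 < (coeffs u).support.card * (coeffs v).support.card := by
    intro h1
    obtain ⟨⟨a, b⟩, hab, ⟨c, d⟩, hcd, hne, h2, h3⟩ := TwoUniqueSums.uniqueAdd_of_one_lt_card h1
    rw [Finset.mem_product] at hab hcd
    have h4 := key a b hab.1 hab.2 h2
    have h5 := key c d hcd.1 hcd.2 h3
    have h6 := h2 hcd.1 hcd.2 (h5.trans h4.symm)
    exact hne (Prod.ext h6.1.symm h6.2.symm)
  have h1 := Finset.card_pos.2 hcu
  have h2 := Finset.card_pos.2 hcv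
  have hu1 : (coeffs u).support.card = 1 := by nlinarith
  have hv1 : (coeffs v).support.card = 1 := by nlinarith
  obtain ⟨α, ζ, hζ, h3⟩ := Finsupp.card_support_eq_one'.1 hu1
  obtain ⟨β, η, hη, h4⟩ := Finsupp.card_support_eq_one'.1 hv1
  have h5 : u = mono α ζ := coeffs_injective h3
  have h6 : v = mono β η := coeffs_injective h4
  rw [h5, h6, mono_mul_mono, ← mono_zero_one] at huv
  have h7 := (mono_inj (mul_ne_zero hζ hη) huv).2
  obtain ⟨c, hc, hcζ⟩ := MvPolynomial.isUnit_iff_eq_C_of_isReduced.1 (IsUnit.of_mul_eq_one η h7)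
  exact ⟨α, c, hc.ne_zero, by rw [h5, hcζ]⟩

/-- The `F`-point of the algebra given by values of the variables and a character of `Γ`. -/
def point (s : Fin ℓ₁ ⊕ Fin ℓ₂ → F) (χ : Multiplicative Γ →* F) : Alg ℓ₁ Γ →ₐ[F] F :=
  AddMonoidAlgebra.liftNCAlgHom (MvPolynomial.aeval s) χ (fun _ _ => Commute.all _ _)

theorem point_mono (s : Fin ℓ₁ ⊕ Fin ℓ₂ → F) (χ : Multiplicative Γ →* F) (α : Γ)
    (ζ : MvPolynomial (Fin ℓ₁ ⊕ Fin ℓ₂) F) :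
    point s χ (mono α ζ) = MvPolynomial.eval s ζ * χ (Multiplicative.ofAdd α) := by
  change AddMonoidAlgebra.liftNC _ _ (AddMonoidAlgebra.single α ζ) = _
  rw [AddMonoidAlgebra.liftNC_single]
  simp [MvPolynomial.coe_aeval_eq_eval]

/-- `Fˣ` is divisible, hence injective as an abelian group, and `α` has infinite order. So the
character of `ℤ α` sending `α` to `2 ≠ 1` extends to `Γ`. -/
theorem exists_character_ne_one [IsAlgClosed F] [CharZero F] {α : Γ} (hα : α ≠ 0) :
    ∃ χ : Multiplicative Γ →* Fˣ, χ (Multiplicative.ofAdd α) ≠ 1 := by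
  have hroot : ∀ {n : ℕ}, n ≠ 0 → Function.Surjective (fun a : Additive Fˣ => n • a) := by
    intro n hn a
    obtain ⟨b, hb⟩ := IsAlgClosed.exists_pow_nat_eq (a.toMul : F) (Nat.pos_of_ne_zero hn)
    have hb0 : b ≠ 0 := by
      rintro rfl
      rw [zero_pow hn] at hb
      exact a.toMul.ne_zero hb.symm
    exact ⟨Additive.ofMul (Units.mk0 b hb0), Additive.toMul.injective (Units.ext (by simpa using hb))⟩
  let _ : DivisibleBy (Additive Fˣ) ℕ := divisibleByOfSMulRightSurj (Additive Fˣ) ℕ hroot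
  let _ : DivisibleBy (Additive Fˣ) ℤ := AddGroup.divisibleByIntOfDivisibleByNat (Additive Fˣ)
  let u : Fˣ := Units.mk0 2 two_ne_zero
  obtain ⟨χ, hχ⟩ := (Module.Baer.of_divisible (Additive Fˣ)).extension_property_addMonoidHom
    (zmultiplesHom Γ α) (by
      intro m n hmn
      obtain ⟨j, hj⟩ := Function.ne_iff.1 (fun h0 => hα (Subtype.ext h0) : (α : Row F ℓ₂ ℓ₃) ≠ 0)
      have h1 := congrFun (congrArg Subtype.val hmn) j
      rw [Pi.zero_apply] at hj
      simpa [hj] using h1) (zmultiplesHom (Additive Fˣ) (Additive.ofMul u))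
  refine ⟨AddMonoidHom.toMultiplicativeLeft χ, fun h1 => ?_⟩
  have h2 : χ α = Additive.ofMul u := by
    have := DFunLike.congr_fun hχ 1
    simpa using this
  have h3 : u = 1 := by
    rw [← h1]
    change u = Additive.toMul (χ α)
    rw [h2]
    rfl
  have h4 : (2 : F) = 1 := congrArg Units.val h3
  norm_num at h4

/-- Evaluations at distinct `α` are distinct characters of the dual group of `Γ`, hence linearly
independent by Dedekind. So for all values of the variables every coefficient vanishes, and `F` is
infinite. -/
theorem points_separate [IsAlgClosed F] [CharZero F] (a : Alg ℓ₁ Γ)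
    (ha : ∀ p : Alg ℓ₁ Γ →ₐ[F] F, p a = 0) : a = 0 := by
  let ev : Γ → ((Multiplicative Γ →* Fˣ) →* F) := fun α =>
    (Units.coeHom F).comp (MonoidHom.eval (Multiplicative.ofAdd α))
  have hev : Function.Injective ev := by
    intro α β hαβ
    by_contra hne
    obtain ⟨χ, hχ⟩ := exists_character_ne_one (sub_ne_zero.2 hne)
    apply hχ
    have h1 : (χ (Multiplicative.ofAdd α) : F) = χ (Multiplicative.ofAdd β) :=
      DFunLike.congr_fun hαβ χ
    rw [ofAdd_sub, map_div, Units.ext h1, div_self']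
  have hli := (linearIndependent_monoidHom (Multiplicative Γ →* Fˣ) F).comp ev hev
  apply coeffs_injective
  ext1 α
  change _ = (0 : MvPolynomial (Fin ℓ₁ ⊕ Fin ℓ₂) F)
  apply MvPolynomial.funext
  intro s
  rw [map_zero]
  let f : Γ →₀ F := (coeffs a).mapRange (MvPolynomial.eval s) (map_zero _)
  have hf : f = 0 := by
    refine linearIndependent_iff.1 hli f ?_
    ext χ
    have h1 := ha (point s ((Units.coeHom F).comp χ))
    rw [← sum_mono_coeffs a, map_finsuppSum] at h1
    rw [Finsupp.linearCombination_apply, Finsupp.sum_mapRange_index (by simp)]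
    simp only [point_mono] at h1
    simpa [Finsupp.sum, ev] using h1
  exact DFunLike.congr_fun hf α

theorem exists_coord_ne_zero (hΓ : IsNondegenerate Γ) (j : Fin ℓ₂ ⊕ Fin ℓ₃) :
    ∃ α : Γ, (α : Row F ℓ₂ ℓ₃) j ≠ 0 := by
  obtain ⟨b, hb⟩ := hΓ
  by_contra! hcon
  have h1 : (LinearMap.proj j : Row F ℓ₂ ℓ₃ →ₗ[F] F) = 0 := b.ext fun i => hcon ⟨b i, hb i⟩
  have h2 := LinearMap.congr_fun h1 (Pi.single j 1)
  simp at h2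

/-- This is how nondegeneracy is used: `Γ` contains a basis, so a linear map that vanishes on `Γ` is
zero. -/
theorem eq_zero_of_forall_sum_smul_eq_zero {M : Type*} [AddCommGroup M] [Module F M]
    (hΓ : IsNondegenerate Γ) {v : Fin ℓ₂ ⊕ Fin ℓ₃ → M}
    (hv : ∀ α : Γ, ∑ j, (α : Row F ℓ₂ ℓ₃) j • v j = 0) : v = 0 := by
  obtain ⟨b, hb⟩ := hΓ
  have h1 : Fintype.linearCombination F v = 0 :=
    b.ext fun i => by simpa [Fintype.linearCombination_apply] using hv ⟨b i, hb i⟩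
  ext j
  have h2 := LinearMap.congr_fun h1 (Pi.single j 1)
  simpa using h2

end Alg

/-! ### The basic derivations form a frame. -/

section Frame

variable {ℓ₁ ℓ₂ ℓ₃ : ℕ}

theorem mem_W_iff {Γ : Omega F ℓ₂ ℓ₃} {X : Derivation F (Alg ℓ₁ Γ.1) (Alg ℓ₁ Γ.1)} :
    X ∈ W ℓ₁ Γ ↔ ∃ u : Fin ℓ₁ ⊕ Fin ℓ₂ ⊕ Fin ℓ₃ → Alg ℓ₁ Γ.1, X = ∑ i, u i • del ℓ₁ Γ.1 i := by
  change X ∈ Submodule.span (Alg ℓ₁ Γ.1) (Submodule.span F (Set.range (del ℓ₁ Γ.1)) : Set _) ↔ _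
  rw [Submodule.span_span_of_tower, Submodule.mem_span_range_iff_exists_fun]
  simp only [eq_comm]

theorem isFrame_del [IsAlgClosed F] [CharZero F] (Γ : Omega F ℓ₂ ℓ₃) :
    IsFrame (W ℓ₁ Γ) (del ℓ₁ Γ.1) where
  mem_iff _ := mem_W_iff
  separates := points_separate
  unit := by
    rintro (i | j | l)
    · refine ⟨mono 0 (MvPolynomial.X (Sum.inl i)), ?_⟩
      simp [del, dt_mono, mono_zero_one]
    · refine ⟨mono 0 (MvPolynomial.X (Sum.inr j)), ?_⟩
      simp [del, dt_mono, dstar_mono, mono_zero, mono_zero_one]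
    · obtain ⟨α, hα⟩ := exists_coord_ne_zero Γ.2 (Sum.inr l)
      refine ⟨mono α 1, ?_⟩
      rw [del, dstar_mono, MvPolynomial.smul_eq_C_mul, mul_one]
      exact isUnit_mono_C α hα

end Frame

open Matrix

/-! ### Values of the basic derivations on `x^α` and on the variables. -/

section Values

variable {ℓ₁ ℓ₂ ℓ₃ : ℕ} {Γ : AddSubgroup (Row F ℓ₂ ℓ₃)}

theorem del_inl_mono_one (i : Fin ℓ₁) (α : Γ) : del ℓ₁ Γ (Sum.inl i) (mono α 1) = 0 := by
  simp [del, dt_mono, mono_zero]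

theorem del_inr_mono_one (j : Fin ℓ₂ ⊕ Fin ℓ₃) (α : Γ) :
    del ℓ₁ Γ (Sum.inr j) (mono α 1) = (α : Row F ℓ₂ ℓ₃) j • mono α 1 := by
  rcases j with j | j <;> simp [del, dt_mono, dstar_mono, mono_zero, mono_smul]

theorem del_X_inl (k : Fin ℓ₁ ⊕ Fin ℓ₂ ⊕ Fin ℓ₃) (i : Fin ℓ₁) :
    del ℓ₁ Γ k (mono 0 (MvPolynomial.X (Sum.inl i))) = if k = Sum.inl i then 1 else 0 := by
  classical
  rcases k with k | k | k
  · simp only [del, dt_mono, MvPolynomial.pderiv_X, Sum.inl.injEq, Pi.single_apply]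
    by_cases hk : k = i
    · simp [hk, mono_zero_one]
    · simp [hk, Ne.symm hk, mono_zero]
  · simp [del, dt_mono, dstar_mono, mono_zero, MvPolynomial.pderiv_X]
  · simp [del, dstar_mono, mono_zero]

theorem del_X_inr (k : Fin ℓ₁ ⊕ Fin ℓ₂ ⊕ Fin ℓ₃) (j : Fin ℓ₂) :
    del ℓ₁ Γ k (mono 0 (MvPolynomial.X (Sum.inr j))) =
      if k = Sum.inr (Sum.inl j) then 1 else 0 := by
  classical
  rcases k with k | k | k
  · simp [del, dt_mono, mono_zero, MvPolynomial.pderiv_X]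
  · simp only [del, Derivation.add_apply, dt_mono, dstar_mono, MvPolynomial.pderiv_X,
      Sum.inr.injEq, Sum.inl.injEq, Pi.single_apply]
    by_cases hk : k = j
    · simp [hk, mono_zero_one, mono_zero]
    · simp [hk, Ne.symm hk, mono_zero]
  · simp [del, dstar_mono, mono_zero]

theorem sum_smul_apply {A ι : Type*} [CommRing A] [Algebra F A] [Fintype ι]
    (u : ι → A) (δ : ι → Derivation F A A) (a : A) :
    (∑ i, u i • δ i) a = ∑ i, u i * δ i a := by
  rw [← Derivation.coeFnAddMonoidHom_apply, map_sum, Finset.sum_apply]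
  rfl

theorem sum_del_mono_one (u : Fin ℓ₁ ⊕ Fin ℓ₂ ⊕ Fin ℓ₃ → Alg ℓ₁ Γ) (α : Γ) :
    (∑ i, u i • del ℓ₁ Γ i) (mono α 1) =
      (∑ j, (α : Row F ℓ₂ ℓ₃) j • u (Sum.inr j)) * mono α 1 := by
  rw [sum_smul_apply, Fintype.sum_sum_type]
  simp only [del_inl_mono_one, del_inr_mono_one, mul_zero, Finset.sum_const_zero, zero_add,
    Finset.sum_mul, smul_mul_assoc, mul_smul_comm]

theorem isUnit_mono_one (α : Γ) : IsUnit (mono α 1 : Alg ℓ₁ Γ) := by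
  simpa using isUnit_mono_C (ℓ₁ := ℓ₁) α (one_ne_zero (α := F))

/-- If all `x^α` are eigenvectors of an element of the Witt type algebra, its coefficients at the
last `ℓ₂ + ℓ₃` basic derivations are constants. -/
theorem exists_const_coeff (hΓ : IsNondegenerate Γ) {u : Fin ℓ₁ ⊕ Fin ℓ₂ ⊕ Fin ℓ₃ → Alg ℓ₁ Γ}
    {w : Γ → F} (hu : ∀ α, (∑ i, u i • del ℓ₁ Γ i) (mono α 1) = w α • mono α 1) :
    ∃ c : Row F ℓ₂ ℓ₃, (∀ j, u (Sum.inr j) = algebraMap F _ (c j)) ∧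
      ∀ α : Γ, (α : Row F ℓ₂ ℓ₃) ⬝ᵥ c = w α := by
  let q : Alg ℓ₁ Γ →ₐ[F] F := point 0 1
  have h1 : ∀ α : Γ, ∑ j, (α : Row F ℓ₂ ℓ₃) j • u (Sum.inr j) = algebraMap F _ (w α) := by
    intro α
    apply (isUnit_mono_one α).mul_right_cancel
    rw [← sum_del_mono_one, hu, Algebra.smul_def]
  have h2 : ∀ α : Γ, (α : Row F ℓ₂ ℓ₃) ⬝ᵥ (fun j => q (u (Sum.inr j))) = w α := by
    intro α
    have := congrArg q (h1 α)
    simpa [dotProduct] using this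
  refine ⟨fun j => q (u (Sum.inr j)), fun j => ?_, h2⟩
  have h3 := eq_zero_of_forall_sum_smul_eq_zero hΓ
    (v := fun j => u (Sum.inr j) - algebraMap F _ (q (u (Sum.inr j)))) (by
      intro α
      simp only [smul_sub, Finset.sum_sub_distrib, h1, sub_eq_zero]
      rw [← h2 α, dotProduct, map_sum]
      simp [Algebra.smul_def])
  exact sub_eq_zero.1 (congrFun h3 j)

end Values

/-! ### Transport of exponents and constant derivations along `σ`. -/

section Transfer

variable {ℓ₁ ℓ₂ ℓ₃ ℓ₁' ℓ₂' ℓ₃' : ℕ} {Γ : Omega F ℓ₂ ℓ₃} {Γ' : Omega F ℓ₂' ℓ₃'}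

theorem del_mem_W (i : Fin ℓ₁ ⊕ Fin ℓ₂ ⊕ Fin ℓ₃) : del ℓ₁ Γ.1 i ∈ W ℓ₁ Γ :=
  Submodule.subset_span (Submodule.subset_span ⟨i, rfl⟩)

/-- The basic derivations as elements of the Witt type algebra. -/
def delW (ℓ₁ : ℕ) (Γ : Omega F ℓ₂ ℓ₃) (i : Fin ℓ₁ ⊕ Fin ℓ₂ ⊕ Fin ℓ₃) : W ℓ₁ Γ :=
  ⟨del ℓ₁ Γ.1 i, del_mem_W i⟩

/-- Evaluation of the elements of the Witt type algebra at `a`, followed by a point. -/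
def evalAt (q : Alg ℓ₁ Γ.1 →ₐ[F] F) (a : Alg ℓ₁ Γ.1) : W ℓ₁ Γ →ₗ[F] F where
  toFun X := q (X.1 a)
  map_add' X Y := by simp
  map_smul' c X := by simp

theorem coe_linearCombination_delW {κ : Type*} [Fintype κ] (e : κ → Fin ℓ₁ ⊕ Fin ℓ₂ ⊕ Fin ℓ₃)
    (c : κ → F) (a : Alg ℓ₁ Γ.1) :
    (Fintype.linearCombination F (fun i => delW ℓ₁ Γ (e i)) c).1 a =
      ∑ i, c i • del ℓ₁ Γ.1 (e i) a := by
  rw [Fintype.linearCombination_apply, AddSubmonoidClass.coe_finsetSum,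
    ← Derivation.coeFnAddMonoidHom_apply, map_sum, Finset.sum_apply]
  rfl

variable [CharZero F] (Φ : W ℓ₁ Γ ≃ₗ⁅F⁆ W ℓ₁' Γ') (σ : Alg ℓ₁ Γ.1 ≃ₐ[F] Alg ℓ₁' Γ'.1)
  (hσ : ∀ (X : W ℓ₁ Γ) (f : Alg ℓ₁ Γ.1), σ (X.1 f) = (Φ X).1 (σ f))

theorem exists_mono_preimage (β : Γ'.1) :
    ∃ (α : Γ.1) (c : F), c ≠ 0 ∧ mono β 1 = c • σ (mono α 1) := by
  obtain ⟨α, c, hc, h⟩ := eq_mono_of_isUnit ((isUnit_mono_one (ℓ₁ := ℓ₁') β).map σ.symm)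
  refine ⟨α, c, hc, ?_⟩
  rw [AlgEquiv.symm_apply_eq, ← mul_one (MvPolynomial.C c), ← MvPolynomial.smul_eq_C_mul,
    mono_smul, map_smul] at h
  exact h

include hσ

/-- A constant combination of the first `ℓ₁` derivations kills all `x^α`, so its image kills all
`x^β` and involves only the first `ℓ₁'` derivations. If their coefficients vanish at `q`, the
original vanishes at the point `q ∘ σ`; its values on the variables are constants, so it is zero. -/
theorem left_rank_le : ℓ₁ ≤ ℓ₁' := by
  let q : Alg ℓ₁' Γ'.1 →ₐ[F] F := point 0 1
  let d : (Fin ℓ₁ → F) →ₗ[F] W ℓ₁ Γ :=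
    Fintype.linearCombination F (fun i => delW ℓ₁ Γ (Sum.inl i))
  let T : (Fin ℓ₁ → F) →ₗ[F] (Fin ℓ₁' → F) := LinearMap.pi fun j =>
    evalAt q (mono 0 (MvPolynomial.X (Sum.inl j))) ∘ₗ (Φ : W ℓ₁ Γ →ₗ[F] W ℓ₁' Γ') ∘ₗ d
  have hT : Function.Injective T := by
    rw [← LinearMap.ker_eq_bot, LinearMap.ker_eq_bot']
    intro c hc
    obtain ⟨u, hu⟩ := mem_W_iff.1 (Φ (d c)).2
    have h1 : ∀ β, (∑ i, u i • del ℓ₁' Γ'.1 i) (mono β 1) = (0 : F) • mono β 1 := by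
      intro β
      obtain ⟨α, b, -, hb⟩ := exists_mono_preimage σ β
      rw [← hu, zero_smul, hb, Derivation.map_smul, ← hσ]
      simp [d, coe_linearCombination_delW, del_inl_mono_one]
    obtain ⟨c', hc', hc'0⟩ := exists_const_coeff Γ'.2 (w := fun _ => 0) h1
    have h2 : c' = 0 := eq_zero_of_forall_sum_smul_eq_zero Γ'.2 (v := c') fun α => by
      simpa [dotProduct] using hc'0 α
    have h3 : ∀ j, q (u (Sum.inl j)) = 0 := by
      intro j
      have h4 : q ((Φ (d c)).1 (mono 0 (MvPolynomial.X (Sum.inl j)))) = 0 := congrFun hc j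
      rw [hu, sum_smul_apply] at h4
      simpa [del_X_inl] using h4
    have h5 : ∀ f, q (σ ((d c).1 f)) = 0 := by
      intro f
      rw [hσ, hu, sum_smul_apply, map_sum]
      refine Finset.sum_eq_zero fun i _ => ?_
      rcases i with i | i
      · rw [map_mul, h3, zero_mul]
      · rw [hc', h2]; simp
    ext i
    have h6 := h5 (mono 0 (MvPolynomial.X (Sum.inl i)))
    simpa [d, coe_linearCombination_delW, del_X_inl] using h6
  simpa using LinearMap.finrank_le_finrank_of_injective hT

/-- Constant derivations go to derivations that are constant modulo those that kill all `x^β`. -/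
theorem exists_dual_vector (c : Row F ℓ₂ ℓ₃) :
    ∃ c' : Row F ℓ₂' ℓ₃', (∀ (α : Γ.1) (β : Γ'.1) (b : F), b ≠ 0 →
      mono β 1 = b • σ (mono α 1) → (β : Row F ℓ₂' ℓ₃') ⬝ᵥ c' = (α : Row F ℓ₂ ℓ₃) ⬝ᵥ c) ∧
      ((∀ j, c (Sum.inl j) = 0) → ∀ j, c' (Sum.inl j) = 0) := by
  let D : W ℓ₁ Γ := Fintype.linearCombination F (fun j => delW ℓ₁ Γ (Sum.inr j)) c
  have hD : ∀ a, D.1 a = ∑ j, c j • del ℓ₁ Γ.1 (Sum.inr j) a := coe_linearCombination_delW _ c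
  obtain ⟨u, hu⟩ := mem_W_iff.1 (Φ D).2
  choose pre b hb0 hb using exists_mono_preimage (ℓ₁ := ℓ₁) σ
  have h0 : ∀ (α : Γ.1) (β : Γ'.1) (b : F), mono β 1 = b • σ (mono α 1) →
      (∑ i, u i • del ℓ₁' Γ'.1 i) (mono β 1) = ((α : Row F ℓ₂ ℓ₃) ⬝ᵥ c) • mono β 1 := by
    intro α β b h
    have hDα : D.1 (mono α 1) = ((α : Row F ℓ₂ ℓ₃) ⬝ᵥ c) • mono α 1 := by
      rw [hD, dotProduct, Finset.sum_smul]
      simp only [del_inr_mono_one, smul_smul, mul_comm]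
    rw [← hu, h, Derivation.map_smul, ← hσ, hDα, map_smul, smul_comm]
  obtain ⟨c', hc', hc'0⟩ := exists_const_coeff Γ'.2 fun β => h0 _ β _ (hb β)
  refine ⟨c', fun α β b hb0' h => ?_, fun hc j => ?_⟩
  · have h1 := (h0 _ β _ (hb β)).symm.trans (h0 α β b h)
    rw [hc'0]
    refine sub_eq_zero.1 (by_contra fun hne => ?_)
    rw [← sub_eq_zero, ← sub_smul] at h1
    rcases smul_eq_zero.1 h1 with h2 | h2
    · exact hne h2
    · exact one_ne_zero (mono_eq_zero.1 h2)
  · by_contra hne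
    -- `D` is now diagonal: it multiplies `ζ x^α` by a scalar that is 0 for `α = 0`. Hence 1 is not
    -- a value of `D`.
    have h1 : ∀ f, coeffs (D.1 f) 0 = 0 := by
      intro f
      induction f using mono_induction with
      | zero => rw [Derivation.map_zero]; rfl
      | add f g hf hg =>
        rw [map_add]
        change coeffs (D.1 f) 0 + coeffs (D.1 g) 0 = 0
        rw [hf, hg, add_zero]
      | mono α ζ =>
        have h2 : D.1 (mono α ζ) =
            mono α ((∑ l, c (Sum.inr l) * (α : Row F ℓ₂ ℓ₃) (Sum.inr l)) • ζ) := by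
          rw [hD, Fintype.sum_sum_type, mono_smul, Finset.sum_smul]
          simp [hc, del, dstar_mono, mono_smul, smul_smul]
        rw [h2, coeffs_mono]
        by_cases hα : α = 0
        · subst hα; simp
        · rw [Finsupp.single_eq_of_ne (Ne.symm hα)]
    -- A nonzero coefficient here would make 1 a value of `Φ D`, hence of `D`.
    have h2 : (Φ D).1 (mono 0 (MvPolynomial.X (Sum.inr j))) = algebraMap F _ (c' (Sum.inl j)) := by
      rw [hu, sum_smul_apply]
      simp [del_X_inr, hc']
    have h3 : D.1 (σ.symm ((c' (Sum.inl j))⁻¹ • mono 0 (MvPolynomial.X (Sum.inr j)))) = 1 := by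
      apply σ.injective
      rw [hσ, AlgEquiv.apply_symm_apply, Derivation.map_smul, h2, map_one, Algebra.smul_def, ← map_mul,
        inv_mul_cancel₀ hne, map_one]
    have h4 := h1 (σ.symm ((c' (Sum.inl j))⁻¹ • mono 0 (MvPolynomial.X (Sum.inr j))))
    rw [h3, ← mono_zero_one, coeffs_mono, Finsupp.single_eq_same] at h4
    exact one_ne_zero h4

/-- The vectors dual to the standard basis form the columns of `M`. If `x^β` is a multiple of
`σ(x^α)`, comparing eigenvalues gives `β M = α`. Injectivity on columns follows because `Γ` contains
a basis, and the zero block is the diagonal case of `exists_dual_vector`. -/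
theorem exists_matrix :
    ∃ M : Matrix (Fin ℓ₂' ⊕ Fin ℓ₃') (Fin ℓ₂ ⊕ Fin ℓ₃) F,
      (∀ β ∈ Γ'.1, β ᵥ* M ∈ Γ.1) ∧ (∀ α ∈ Γ.1, ∃ β ∈ Γ'.1, β ᵥ* M = α) ∧
      (∀ v, M *ᵥ v = 0 → v = 0) ∧ ∀ i j, M (Sum.inl i) (Sum.inr j) = 0 := by
  classical
  choose T hT hT0 using exists_dual_vector Φ σ hσ
  let M : Matrix (Fin ℓ₂' ⊕ Fin ℓ₃') (Fin ℓ₂ ⊕ Fin ℓ₃) F :=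
    Matrix.of fun i j => T (Pi.single j 1) i
  have hM : ∀ (α : Γ.1) (β : Γ'.1) (b : F), b ≠ 0 → mono β 1 = b • σ (mono α 1) →
      (β : Row F ℓ₂' ℓ₃') ᵥ* M = α := by
    intro α β b hb h
    ext j
    have := hT (Pi.single j 1) α β b hb h
    rw [dotProduct_single, mul_one] at this
    exact this
  have hsurj : ∀ α ∈ Γ.1, ∃ β ∈ Γ'.1, β ᵥ* M = α := by
    intro α hα
    obtain ⟨β, b, hb, h⟩ := exists_mono_preimage σ.symm (⟨α, hα⟩ : Γ.1)
    refine ⟨β, β.2, hM ⟨α, hα⟩ β b⁻¹ (inv_ne_zero hb) ?_⟩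
    rw [h, map_smul, AlgEquiv.apply_symm_apply, smul_smul, inv_mul_cancel₀ hb, one_smul]
  refine ⟨M, fun β hβ => ?_, hsurj, fun v hv => ?_, fun i j => ?_⟩
  · obtain ⟨α, b, hb, h⟩ := exists_mono_preimage (ℓ₁ := ℓ₁) σ ⟨β, hβ⟩
    rw [hM α ⟨β, hβ⟩ b hb h]
    exact α.2
  · refine eq_zero_of_forall_sum_smul_eq_zero Γ.2 fun α => ?_
    obtain ⟨β, -, hβ⟩ := hsurj α α.2
    have : (α : Row F ℓ₂ ℓ₃) ⬝ᵥ v = 0 := by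
      rw [← hβ, ← dotProduct_mulVec, hv, dotProduct_zero]
    simpa [dotProduct] using this
  · exact hT0 _ (fun j => by simp) i

end Transfer

/-! ### Block triangular matrices and ranks. -/

section BlockMatrix

theorem toBlocks₂₂_mulVec_eq_zero {ℓ₂ ℓ₃ ℓ₂' ℓ₃' : ℕ}
    {M : Matrix (Fin ℓ₂' ⊕ Fin ℓ₃') (Fin ℓ₂ ⊕ Fin ℓ₃) F}
    (hM : ∀ v, M *ᵥ v = 0 → v = 0) (h0 : ∀ i j, M (Sum.inl i) (Sum.inr j) = 0) (v : Fin ℓ₃ → F)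
    (hv : M.toBlocks₂₂ *ᵥ v = 0) : v = 0 := by
  have h12 : M.toBlocks₁₂ = 0 := by
    ext i j; exact h0 i j
  have h1 : M *ᵥ (Sum.elim 0 v) = 0 := by
    rw [← Matrix.fromBlocks_toBlocks M, Matrix.fromBlocks_mulVec, h12]
    ext i
    rcases i with i | i
    · simp
    · simpa using congrFun hv i
  ext i
  exact congrFun (hM _ h1) (Sum.inr i)

theorem card_le_of_mulVec_injective {m n : Type*} [Fintype m] [Fintype n] {M : Matrix m n F}
    (hM : ∀ v, M *ᵥ v = 0 → v = 0) : Fintype.card n ≤ Fintype.card m := by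
  have : Function.Injective M.mulVecLin := by
    rw [← LinearMap.ker_eq_bot, LinearMap.ker_eq_bot']
    exact hM
  simpa using LinearMap.finrank_le_finrank_of_injective this

end BlockMatrix

section Classification

variable [IsAlgClosed F] [CharZero F]

/-- Applied to `Φ` and its inverse, injectivity of `M` compares `ℓ₂ + ℓ₃`, injectivity of its lower
right block compares `ℓ₃`, and `left_rank_le` compares `ℓ₁`. -/
theorem data_eq_of_lieEquiv {ℓ₁ ℓ₂ ℓ₃ ℓ₁' ℓ₂' ℓ₃' : ℕ} (hpos : 0 < ℓ₁ + ℓ₂ + ℓ₃)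
    (hpos' : 0 < ℓ₁' + ℓ₂' + ℓ₃') {Γ : Omega F ℓ₂ ℓ₃} {Γ' : Omega F ℓ₂' ℓ₃'}
    (Φ : W ℓ₁ Γ ≃ₗ⁅F⁆ W ℓ₁' Γ') :
    (ℓ₁ = ℓ₁' ∧ ℓ₂ = ℓ₂' ∧ ℓ₃ = ℓ₃') ∧
    ∃ M : Matrix (Fin ℓ₂' ⊕ Fin ℓ₃') (Fin ℓ₂ ⊕ Fin ℓ₃) F,
      (∀ β ∈ Γ'.1, β ᵥ* M ∈ Γ.1) ∧ (∀ α ∈ Γ.1, ∃ β ∈ Γ'.1, β ᵥ* M = α) ∧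
      (∀ v, M *ᵥ v = 0 → v = 0) ∧ ∀ i j, M (Sum.inl i) (Sum.inr j) = 0 := by
  have : Nonempty (Fin ℓ₁ ⊕ Fin ℓ₂ ⊕ Fin ℓ₃) := Fintype.card_pos_iff.1 (by
    simp only [Fintype.card_sum, Fintype.card_fin]
    omega)
  have : Nonempty (Fin ℓ₁' ⊕ Fin ℓ₂' ⊕ Fin ℓ₃') := Fintype.card_pos_iff.1 (by
    simp only [Fintype.card_sum, Fintype.card_fin]
    omega)
  obtain ⟨σ, hσ⟩ := (isFrame_del (ℓ₁ := ℓ₁) Γ).exists_algEquiv (isFrame_del (ℓ₁ := ℓ₁') Γ') Φ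
  have hσ' : ∀ (X : W ℓ₁' Γ') (f : Alg ℓ₁' Γ'.1), σ.symm (X.1 f) = (Φ.symm X).1 (σ.symm f) := by
    intro X f
    rw [AlgEquiv.symm_apply_eq, hσ]
    simp
  obtain ⟨M, h1, h2, h3, h4⟩ := exists_matrix Φ σ hσ
  obtain ⟨M', -, -, h3', h4'⟩ := exists_matrix Φ.symm σ.symm hσ'
  have a1 := left_rank_le Φ σ hσ
  have a2 := left_rank_le Φ.symm σ.symm hσ'
  have b1 := card_le_of_mulVec_injective h3
  have b2 := card_le_of_mulVec_injective h3'
  have c1 := card_le_of_mulVec_injective (toBlocks₂₂_mulVec_eq_zero h3 h4)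
  have c2 := card_le_of_mulVec_injective (toBlocks₂₂_mulVec_eq_zero h3' h4')
  simp only [Fintype.card_sum, Fintype.card_fin] at b1 b2 c1 c2
  exact ⟨⟨by omega, by omega, by omega⟩, M, h1, h2, h3, h4⟩

-- The group element is `M` itself: the action is `α ↦ α M⁻¹`, and `Γ' M = Γ`.
omit [IsAlgClosed F] [CharZero F] in
theorem exists_group_element {ℓ₂ ℓ₃ : ℕ} {Γ Γ' : Omega F ℓ₂ ℓ₃}
    {M : Matrix (Fin ℓ₂ ⊕ Fin ℓ₃) (Fin ℓ₂ ⊕ Fin ℓ₃) F}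
    (h1 : ∀ β ∈ Γ'.1, β ᵥ* M ∈ Γ.1) (h2 : ∀ α ∈ Γ.1, ∃ β ∈ Γ'.1, β ᵥ* M = α)
    (h3 : ∀ v, M *ᵥ v = 0 → v = 0) (h4 : ∀ i j, M (Sum.inl i) (Sum.inr j) = 0) :
    ∃ g : G F ℓ₂ ℓ₃, g • Γ = Γ' := by
  have unit : ∀ {n : Type} [Fintype n] [DecidableEq n] {N : Matrix n n F},
      (∀ v, N *ᵥ v = 0 → v = 0) → IsUnit N.det := by
    intro n _ _ N hN
    rw [← Matrix.isUnit_iff_isUnit_det, ← Matrix.mulVec_injective_iff_isUnit]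
    intro v w hvw
    have : N *ᵥ (v - w) = 0 := by rw [Matrix.mulVec_sub]; exact sub_eq_zero.2 hvw
    exact sub_eq_zero.1 (hN _ this)
  have hM := unit h3
  have hC := unit (toBlocks₂₂_mulVec_eq_zero h3 h4)
  have h12 : M.toBlocks₁₂ = 0 := by
    ext i j; exact h4 i j
  have hblocks : M = Matrix.fromBlocks M.toBlocks₁₁ 0 M.toBlocks₂₁ M.toBlocks₂₂ := by
    rw [← h12, Matrix.fromBlocks_toBlocks]
  have hA : IsUnit M.toBlocks₁₁.det := by
    rw [hblocks, Matrix.det_fromBlocks_zero₁₂] at hM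
    exact isUnit_of_mul_isUnit_left hM
  let g₀ : GL (Fin ℓ₂ ⊕ Fin ℓ₃) F := Matrix.nonsingInvUnit M hM
  have hg : g₀ ∈ G F ℓ₂ ℓ₃ :=
    ⟨Matrix.nonsingInvUnit _ hA, M.toBlocks₂₁, Matrix.nonsingInvUnit _ hC, hblocks⟩
  have hact : ∀ α, rowAct ⟨g₀, hg⟩ α = α ᵥ* M⁻¹ := fun α => rfl
  refine ⟨⟨g₀, hg⟩, Subtype.ext (AddSubgroup.ext fun β => ⟨?_, fun hβ => ?_⟩)⟩
  · rintro ⟨α, hα, rfl⟩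
    obtain ⟨β, hβ, rfl⟩ := h2 α hα
    change rowAct ⟨g₀, hg⟩ (β ᵥ* M) ∈ _
    rwa [hact, Matrix.vecMul_vecMul, Matrix.mul_nonsing_inv _ hM, Matrix.vecMul_one]
  · refine ⟨β ᵥ* M, h1 β hβ, ?_⟩
    change rowAct ⟨g₀, hg⟩ (β ᵥ* M) = _
    rw [hact, Matrix.vecMul_vecMul, Matrix.mul_nonsing_inv _ hM, Matrix.vecMul_one]

end Classification

/-! ### Conjugating derivations by an algebra isomorphism. -/

section Conjugation

variable {A A' : Type*} [CommRing A] [Algebra F A] [CommRing A'] [Algebra F A']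

/-- The derivation `σ ∘ D ∘ σ⁻¹`. -/
def conj (σ : A ≃ₐ[F] A') (D : Derivation F A A) : Derivation F A' A' :=
  Derivation.mk' (σ.toLinearMap ∘ₗ D.toLinearMap ∘ₗ σ.symm.toLinearMap) (by
    intro a b
    simp [Derivation.leibniz])

theorem conj_apply (σ : A ≃ₐ[F] A') (D : Derivation F A A) (a : A') :
    conj σ D a = σ (D (σ.symm a)) := rfl

/-- Conjugation by an algebra isomorphism that matches two Lie algebras of derivations. -/
def conjLieEquiv (σ : A ≃ₐ[F] A') {W : LieSubalgebra F (Derivation F A A)}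
    {W' : LieSubalgebra F (Derivation F A' A')} (h : ∀ D ∈ W, conj σ D ∈ W')
    (h' : ∀ D ∈ W', conj σ.symm D ∈ W) : W ≃ₗ⁅F⁆ W' where
  toFun X := ⟨conj σ X.1, h X.1 X.2⟩
  invFun X := ⟨conj σ.symm X.1, h' X.1 X.2⟩
  map_add' X Y := Subtype.ext (by ext a; simp [conj_apply])
  map_smul' c X := Subtype.ext (by ext a; simp [conj_apply])
  map_lie' {X Y} := Subtype.ext (by ext a; simp [conj_apply, Derivation.commutator_apply])
  left_inv X := Subtype.ext (by ext a; simp [conj_apply])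
  right_inv X := Subtype.ext (by ext a; simp [conj_apply])

theorem conj_sum_smul {ι : Type*} [Fintype ι] (σ : A ≃ₐ[F] A') (u : ι → A)
    (δ : ι → Derivation F A A) :
    conj σ (∑ i, u i • δ i) = ∑ i, σ (u i) • conj σ (δ i) := by
  ext a
  rw [sum_smul_apply, conj_apply, sum_smul_apply, map_sum]
  simp [conj_apply]

end Conjugation

/-! ### The algebra isomorphism attached to a block triangular matrix. -/

section ChangeOfVariables

variable {ℓ₁ ℓ₂ ℓ₃ : ℕ}

/-- The linear change of variables `t_i ↦ t_i` for `i ≤ ℓ₁` and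
`t_{ℓ₁+k} ↦ ∑ⱼ M_{kj} t_{ℓ₁+j}`. -/
def changeVars (ℓ₁ : ℕ) (M : Matrix (Fin ℓ₂ ⊕ Fin ℓ₃) (Fin ℓ₂ ⊕ Fin ℓ₃) F) :
    MvPolynomial (Fin ℓ₁ ⊕ Fin ℓ₂) F →ₐ[F] MvPolynomial (Fin ℓ₁ ⊕ Fin ℓ₂) F :=
  MvPolynomial.aeval (Sum.elim (fun i => MvPolynomial.X (Sum.inl i))
    (fun k => ∑ j, M (Sum.inl k) (Sum.inl j) • MvPolynomial.X (Sum.inr j)))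

/-- Only upper left blocks enter, and these are inverse to each other because the upper right block
of `M` is zero. -/
theorem changeVars_comp {M N : Matrix (Fin ℓ₂ ⊕ Fin ℓ₃) (Fin ℓ₂ ⊕ Fin ℓ₃) F} (hMN : M * N = 1)
    (h0 : ∀ i j, M (Sum.inl i) (Sum.inr j) = 0) (ζ : MvPolynomial (Fin ℓ₁ ⊕ Fin ℓ₂) F) :
    changeVars ℓ₁ N (changeVars ℓ₁ M ζ) = ζ := by
  have : (changeVars ℓ₁ N).comp (changeVars ℓ₁ M) = AlgHom.id F _ := by
    apply MvPolynomial.algHom_ext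
    rintro (i | k)
    · simp [changeVars]
    · have h1 : ∀ l, ∑ j, M (Sum.inl k) (Sum.inl j) * N (Sum.inl j) (Sum.inl l) =
          if k = l then 1 else 0 := by
        intro l
        have := congrFun (congrFun hMN (Sum.inl k)) (Sum.inl l)
        rw [Matrix.mul_apply, Fintype.sum_sum_type] at this
        simpa [h0, Matrix.one_apply] using this
      simp only [changeVars, AlgHom.comp_apply, MvPolynomial.aeval_X, Sum.elim_inr, map_sum,
        map_smul, Finset.smul_sum, smul_smul]
      rw [Finset.sum_comm]
      simp only [← Finset.sum_smul, h1]
      simp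
  exact DFunLike.congr_fun this ζ

/-- The chain rule. -/
theorem pderiv_aeval {κ τ : Type*} [Fintype κ] (S : κ → MvPolynomial τ F) (v : τ)
    (ζ : MvPolynomial κ F) :
    MvPolynomial.pderiv v (MvPolynomial.aeval S ζ) =
      ∑ w, MvPolynomial.aeval S (MvPolynomial.pderiv w ζ) * MvPolynomial.pderiv v (S w) := by
  classical
  induction ζ using MvPolynomial.induction_on with
  | C a => simp
  | add p q hp hq => simp only [map_add, hp, hq, add_mul, Finset.sum_add_distrib]
  | mul_X p w hp =>
    simp only [map_mul, Derivation.leibniz, hp, smul_eq_mul, MvPolynomial.aeval_X, map_add,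
      MvPolynomial.pderiv_X, add_mul, Finset.sum_add_distrib, Finset.mul_sum]
    congr 1
    · rw [Finset.sum_eq_single w]
      · simp
      · intro b _ hb
        simp [Pi.single_eq_of_ne hb.symm]
      · simp
    · exact Finset.sum_congr rfl fun b _ => by ring

theorem pderiv_inl_changeVars (M : Matrix (Fin ℓ₂ ⊕ Fin ℓ₃) (Fin ℓ₂ ⊕ Fin ℓ₃) F) (i : Fin ℓ₁)
    (ζ : MvPolynomial (Fin ℓ₁ ⊕ Fin ℓ₂) F) :
    MvPolynomial.pderiv (Sum.inl i) (changeVars ℓ₁ M ζ) =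
      changeVars ℓ₁ M (MvPolynomial.pderiv (Sum.inl i) ζ) := by
  classical
  rw [changeVars, pderiv_aeval, Fintype.sum_sum_type, Finset.sum_eq_single i]
  · simp [MvPolynomial.pderiv_X]
  · intro b _ hb
    simp [MvPolynomial.pderiv_X, hb]
  · simp

theorem pderiv_inr_changeVars (M : Matrix (Fin ℓ₂ ⊕ Fin ℓ₃) (Fin ℓ₂ ⊕ Fin ℓ₃) F) (j : Fin ℓ₂)
    (ζ : MvPolynomial (Fin ℓ₁ ⊕ Fin ℓ₂) F) :
    MvPolynomial.pderiv (Sum.inr j) (changeVars ℓ₁ M ζ) =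
      ∑ k, M (Sum.inl k) (Sum.inl j) •
        changeVars ℓ₁ M (MvPolynomial.pderiv (Sum.inr k) ζ) := by
  classical
  rw [changeVars, pderiv_aeval, Fintype.sum_sum_type]
  have h1 : ∀ k, MvPolynomial.pderiv (Sum.inr j) (∑ l, M (Sum.inl k) (Sum.inl l) •
      (MvPolynomial.X (Sum.inr l) : MvPolynomial (Fin ℓ₁ ⊕ Fin ℓ₂) F)) =
      MvPolynomial.C (M (Sum.inl k) (Sum.inl j)) := by
    intro k
    rw [map_sum, Finset.sum_eq_single j]
    · simp [MvPolynomial.smul_eq_C_mul]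
    · intro b _ hb
      simp [MvPolynomial.pderiv_X, hb]
    · simp
  have h2 : ∀ i : Fin ℓ₁, MvPolynomial.pderiv (Sum.inr j)
      (MvPolynomial.X (Sum.inl i) : MvPolynomial (Fin ℓ₁ ⊕ Fin ℓ₂) F) = 0 := fun i =>
    MvPolynomial.pderiv_X_of_ne (by simp)
  simp only [Sum.elim_inl, Sum.elim_inr, h1, h2, mul_zero, Finset.sum_const_zero, zero_add]
  exact Finset.sum_congr rfl fun k _ => by rw [MvPolynomial.smul_eq_C_mul, mul_comm]

/-- The algebra homomorphism `ζ x^α ↦ ζ' x^{α M}`, where `ζ'` is obtained from `ζ` by the linear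
change of variables. -/
def twistHom (ℓ₁ : ℕ) {Γ Γ' : AddSubgroup (Row F ℓ₂ ℓ₃)}
    (M : Matrix (Fin ℓ₂ ⊕ Fin ℓ₃) (Fin ℓ₂ ⊕ Fin ℓ₃) F) (hM : ∀ α ∈ Γ, α ᵥ* M ∈ Γ') :
    Alg ℓ₁ Γ →ₐ[F] Alg ℓ₁ Γ' :=
  AddMonoidAlgebra.liftNCAlgHom (B := Alg ℓ₁ Γ')
    ((AddMonoidAlgebra.singleZeroAlgHom (R := F) (A := MvPolynomial (Fin ℓ₁ ⊕ Fin ℓ₂) F)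
      (M := Γ')).comp (changeVars ℓ₁ M))
    { toFun := fun α => mono ⟨α.toAdd.1 ᵥ* M, hM _ α.toAdd.2⟩ 1
      map_one' := by
        rw [← mono_zero_one]
        congr 1
        exact Subtype.ext (Matrix.zero_vecMul M)
      map_mul' := fun α β => by
        rw [mono_mul_mono, one_mul]
        congr 1
        exact Subtype.ext (Matrix.add_vecMul M _ _) }
    (fun _ _ => Commute.all _ _)

variable {Γ Γ' : AddSubgroup (Row F ℓ₂ ℓ₃)} {M N : Matrix (Fin ℓ₂ ⊕ Fin ℓ₃) (Fin ℓ₂ ⊕ Fin ℓ₃) F}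

theorem twistHom_mono (hM : ∀ α ∈ Γ, α ᵥ* M ∈ Γ') (α : Γ)
    (ζ : MvPolynomial (Fin ℓ₁ ⊕ Fin ℓ₂) F) :
    twistHom ℓ₁ M hM (mono α ζ) = mono ⟨α.1 ᵥ* M, hM _ α.2⟩ (changeVars ℓ₁ M ζ) := by
  change AddMonoidAlgebra.liftNC _ _ (AddMonoidAlgebra.single α ζ) = _
  rw [AddMonoidAlgebra.liftNC_single]
  change (mono 0 (changeVars ℓ₁ M ζ) * mono ⟨α.1 ᵥ* M, hM _ α.2⟩ 1 : Alg ℓ₁ Γ') = _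
  rw [mono_mul_mono, zero_add, mul_one]

theorem twistHom_comp (hM : ∀ α ∈ Γ, α ᵥ* M ∈ Γ') (hN : ∀ α ∈ Γ', α ᵥ* N ∈ Γ) (hMN : M * N = 1)
    (h0 : ∀ i j, M (Sum.inl i) (Sum.inr j) = 0) (a : Alg ℓ₁ Γ) :
    twistHom ℓ₁ N hN (twistHom ℓ₁ M hM a) = a := by
  induction a using mono_induction with
  | zero => simp
  | add f g hf hg => rw [map_add, map_add, hf, hg]
  | mono α ζ =>
    rw [twistHom_mono, twistHom_mono, changeVars_comp hMN h0]
    congr 1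
    apply Subtype.ext
    simp [Matrix.vecMul_vecMul, hMN]

/-- The grading parts transform by all of `M` and the `∂_t` parts by its upper left block. The zero
upper right block is what lets the two recombine into the `∂ₖ`: no `∂*_j + ∂_{t_{ℓ₁+j}}` occurs in
the transform of a pure grading operator. -/
theorem del_twistHom (hM : ∀ α ∈ Γ, α ᵥ* M ∈ Γ') (h0 : ∀ i j, M (Sum.inl i) (Sum.inr j) = 0)
    (i : Fin ℓ₁ ⊕ Fin ℓ₂ ⊕ Fin ℓ₃) :
    ∃ u : Fin ℓ₁ ⊕ Fin ℓ₂ ⊕ Fin ℓ₃ → Alg ℓ₁ Γ, ∀ a,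
      del ℓ₁ Γ' i (twistHom ℓ₁ M hM a) = twistHom ℓ₁ M hM ((∑ k, u k • del ℓ₁ Γ k) a) := by
  classical
  have reduce : ∀ u : Fin ℓ₁ ⊕ Fin ℓ₂ ⊕ Fin ℓ₃ → Alg ℓ₁ Γ, (∀ α ζ,
      del ℓ₁ Γ' i (twistHom ℓ₁ M hM (mono α ζ)) =
        twistHom ℓ₁ M hM ((∑ k, u k • del ℓ₁ Γ k) (mono α ζ))) →
      ∀ a, del ℓ₁ Γ' i (twistHom ℓ₁ M hM a) = twistHom ℓ₁ M hM ((∑ k, u k • del ℓ₁ Γ k) a) := by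
    intro u hu a
    induction a using mono_induction with
    | zero => simp
    | add f g hf hg => rw [map_add, map_add, map_add, map_add, hf, hg]
    | mono α ζ => exact hu α ζ
  rcases i with i | v
  · refine ⟨Pi.single (Sum.inl i) 1, reduce _ fun α ζ => ?_⟩
    rw [sum_smul_apply, Finset.sum_eq_single (Sum.inl i)]
    · simp [del, dt_mono, twistHom_mono, pderiv_inl_changeVars]
    · intro b _ hb
      rw [Pi.single_eq_of_ne hb, zero_mul]
    · simp
  -- The coefficients are column `v` of `M`, since `(α M)_v = ∑ₖ αₖ M_{kv}`.
  · refine ⟨Sum.elim 0 (fun k => algebraMap F _ (M k v)), reduce _ fun α ζ => ?_⟩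
    rw [sum_smul_apply, Fintype.sum_sum_type]
    simp only [Sum.elim_inl, Sum.elim_inr, Pi.zero_apply, zero_mul, Finset.sum_const_zero,
      zero_add, ← Algebra.smul_def, map_sum, map_smul]
    have hsum : ∀ {κ : Type} [Fintype κ] (f : κ → MvPolynomial (Fin ℓ₁ ⊕ Fin ℓ₂) F) (β : Γ'),
        mono β (∑ k, f k) = ∑ k, mono β (f k) := fun {κ} _ f β =>
      map_sum (AddMonoidHom.mk' (mono β) (mono_add β)) _ _
    have hα : (α.1 ᵥ* M) v • changeVars ℓ₁ M ζ = ∑ k, (M k v * α.1 k) • changeVars ℓ₁ M ζ := by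
      rw [← Finset.sum_smul]
      simp only [Matrix.vecMul, dotProduct, mul_comm]
    rcases v with j | l
    · rw [del, twistHom_mono, Derivation.add_apply, dstar_mono, dt_mono, ← mono_add, hα,
        pderiv_inr_changeVars, Fintype.sum_sum_type, Fintype.sum_sum_type]
      simp only [del, Derivation.add_apply, dstar_mono, dt_mono, map_add, twistHom_mono, map_smul,
        smul_add, ← mono_smul, ← mono_add, smul_smul]
      rw [← hsum, ← hsum, ← mono_add, Finset.sum_add_distrib]
      congr 1
      abel
    · rw [del, twistHom_mono, dstar_mono, hα, Fintype.sum_sum_type, Fintype.sum_sum_type]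
      simp only [h0, zero_mul, zero_smul, Finset.sum_const_zero, zero_add, del, dstar_mono,
        twistHom_mono, map_smul]
      simp only [← mono_smul, smul_smul, hsum]

end ChangeOfVariables

/-! ### The isomorphism criterion and equality of invariants. -/

section Classification

variable {ℓ₁ ℓ₂ ℓ₃ : ℕ}

theorem smul_mem_W {Γ : Omega F ℓ₂ ℓ₃} (f : Alg ℓ₁ Γ.1)
    {X : Derivation F (Alg ℓ₁ Γ.1) (Alg ℓ₁ Γ.1)} (hX : X ∈ W ℓ₁ Γ) : f • X ∈ W ℓ₁ Γ := by
  obtain ⟨u, rfl⟩ := mem_W_iff.1 hX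
  exact mem_W_iff.2 ⟨fun i => f * u i, by simp only [Finset.smul_sum, mul_smul]⟩

theorem conj_mem_W {Γ Γ' : Omega F ℓ₂ ℓ₃} (σ : Alg ℓ₁ Γ.1 ≃ₐ[F] Alg ℓ₁ Γ'.1)
    (h : ∀ i, conj σ (del ℓ₁ Γ.1 i) ∈ W ℓ₁ Γ') (D : Derivation F (Alg ℓ₁ Γ.1) (Alg ℓ₁ Γ.1))
    (hD : D ∈ W ℓ₁ Γ) : conj σ D ∈ W ℓ₁ Γ' := by
  obtain ⟨u, rfl⟩ := mem_W_iff.1 hD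
  rw [conj_sum_smul]
  exact sum_mem fun i _ => smul_mem_W _ (h i)

theorem nonempty_lieEquiv_of_matrix {Γ Γ' : Omega F ℓ₂ ℓ₃}
    {M N : Matrix (Fin ℓ₂ ⊕ Fin ℓ₃) (Fin ℓ₂ ⊕ Fin ℓ₃) F}
    (hM : ∀ α ∈ Γ.1, α ᵥ* M ∈ Γ'.1) (hN : ∀ α ∈ Γ'.1, α ᵥ* N ∈ Γ.1) (hMN : M * N = 1)
    (hM0 : ∀ i j, M (Sum.inl i) (Sum.inr j) = 0) (hN0 : ∀ i j, N (Sum.inl i) (Sum.inr j) = 0) :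
    Nonempty (W ℓ₁ Γ ≃ₗ⁅F⁆ W ℓ₁ Γ') := by
  have hNM : N * M = 1 := mul_eq_one_comm.1 hMN
  let σ : Alg ℓ₁ Γ.1 ≃ₐ[F] Alg ℓ₁ Γ'.1 :=
    AlgEquiv.ofAlgHom (twistHom ℓ₁ M hM) (twistHom ℓ₁ N hN)
      (AlgHom.ext (twistHom_comp hN hM hNM hN0)) (AlgHom.ext (twistHom_comp hM hN hMN hM0))
  refine ⟨conjLieEquiv σ (conj_mem_W σ fun i => ?_) (conj_mem_W σ.symm fun i => ?_)⟩
  · obtain ⟨u, hu⟩ := del_twistHom (ℓ₁ := ℓ₁) hN hN0 i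
    refine mem_W_iff.2 ⟨u, Derivation.ext fun a => ?_⟩
    rw [conj_apply, ← AlgEquiv.eq_symm_apply]
    exact hu a
  · obtain ⟨u, hu⟩ := del_twistHom (ℓ₁ := ℓ₁) hM hM0 i
    refine mem_W_iff.2 ⟨u, Derivation.ext fun a => ?_⟩
    rw [conj_apply, ← AlgEquiv.eq_symm_apply]
    exact hu a

theorem apply_inl_inr_eq_zero (g : G F ℓ₂ ℓ₃) (i : Fin ℓ₂) (j : Fin ℓ₃) :
    (g : GL (Fin ℓ₂ ⊕ Fin ℓ₃) F).1 (Sum.inl i) (Sum.inr j) = 0 := by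
  obtain ⟨A, B, C, h⟩ := g.2
  rw [h]
  rfl

/-- The exponents are twisted by `g⁻¹`, because `g` acts by `α ↦ α g⁻¹`. -/
theorem nonempty_lieEquiv_smul (g : G F ℓ₂ ℓ₃) (Γ : Omega F ℓ₂ ℓ₃) :
    Nonempty (W ℓ₁ Γ ≃ₗ⁅F⁆ W ℓ₁ (g • Γ)) := by
  refine nonempty_lieEquiv_of_matrix (M := ((g⁻¹ : G F ℓ₂ ℓ₃) : GL (Fin ℓ₂ ⊕ Fin ℓ₃) F).1)
    (N := (g : GL (Fin ℓ₂ ⊕ Fin ℓ₃) F).1) (fun α hα => ⟨α, hα, rfl⟩) ?_ ?_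
    (apply_inl_inr_eq_zero g⁻¹) (apply_inl_inr_eq_zero g)
  · rintro _ ⟨α, hα, rfl⟩
    change (α ᵥ* ((g⁻¹ : G F ℓ₂ ℓ₃) : GL (Fin ℓ₂ ⊕ Fin ℓ₃) F).1) ᵥ* _ ∈ _
    rw [Matrix.vecMul_vecMul, ← Units.val_mul, ← Subgroup.coe_mul, inv_mul_cancel]
    simpa using hα
  · rw [← Units.val_mul, ← Subgroup.coe_mul, inv_mul_cancel]
    simp

theorem map_rowCast_rfl (Γ : AddSubgroup (Row F ℓ₂ ℓ₃)) :
    Γ.map (rowCast (F := F) (rfl : ℓ₂ = ℓ₂) (rfl : ℓ₃ = ℓ₃)).toAddMonoidHom = Γ := by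
  have : (rowCast (F := F) (rfl : ℓ₂ = ℓ₂) (rfl : ℓ₃ = ℓ₃)).toAddMonoidHom =
      AddMonoidHom.id _ := by
    refine AddMonoidHom.ext fun v => funext fun i => ?_
    rcases i with i | i <;> rfl
  rw [this, AddSubgroup.map_id]

theorem nonempty_lieEquiv_iff [IsAlgClosed F] [CharZero F] {ℓ₁' ℓ₂' ℓ₃' : ℕ}
    (hpos : 0 < ℓ₁ + ℓ₂ + ℓ₃) (hpos' : 0 < ℓ₁' + ℓ₂' + ℓ₃') (Γ : Omega F ℓ₂ ℓ₃)
    (Γ' : Omega F ℓ₂' ℓ₃') :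
    Nonempty (W ℓ₁ Γ ≃ₗ⁅F⁆ W ℓ₁' Γ') ↔
      ℓ₁ = ℓ₁' ∧ ∃ (h₂ : ℓ₂ = ℓ₂') (h₃ : ℓ₃ = ℓ₃'), ∃ g : G F ℓ₂ ℓ₃,
        (g • Γ).1.map (rowCast h₂ h₃).toAddMonoidHom = Γ'.1 := by
  constructor
  · rintro ⟨Φ⟩
    obtain ⟨⟨rfl, rfl, rfl⟩, M, h1, h2, h3, h4⟩ := data_eq_of_lieEquiv hpos hpos' Φ
    obtain ⟨g, hg⟩ := exists_group_element h1 h2 h3 h4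
    exact ⟨rfl, rfl, rfl, g, by rw [hg, map_rowCast_rfl]⟩
  · rintro ⟨rfl, rfl, rfl, g, hg⟩
    rw [map_rowCast_rfl] at hg
    rw [← (Subtype.ext hg : g • Γ = Γ')]
    exact nonempty_lieEquiv_smul g Γ

theorem Datum.toSW_eq_iff (d d' : Datum F) :
    d.toSW = d'.toSW ↔ d.ℓ₁ = d'.ℓ₁ ∧ ∃ (h₂ : d.ℓ₂ = d'.ℓ₂) (h₃ : d.ℓ₃ = d'.ℓ₃),
      ∃ g : G F d.ℓ₂ d.ℓ₃, (g • d.Γ).1.map (rowCast h₂ h₃).toAddMonoidHom = d'.Γ.1 := by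
  obtain ⟨ℓ₁, ℓ₂, ℓ₃, pos, Γ⟩ := d
  obtain ⟨ℓ₁', ℓ₂', ℓ₃', pos', Γ'⟩ := d'
  constructor
  · intro h
    have h1 : (ℓ₁, ℓ₂, ℓ₃) = (ℓ₁', ℓ₂', ℓ₃') := congrArg (fun x : SW F => x.1.1) h
    simp only [Prod.mk.injEq] at h1
    obtain ⟨rfl, rfl, rfl⟩ := h1
    -- The equality is reversed because the orbit relation puts its first argument in the orbit of
    -- the second, and `g • Γ = Γ'` is wanted.
    have h2 : (Quotient.mk _ Γ' : Moduli F ℓ₂ ℓ₃) = Quotient.mk _ Γ :=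
      (eq_of_heq (Sigma.mk.inj h).2).symm
    obtain ⟨g, hg⟩ := MulAction.orbitRel_apply.1 (Quotient.exact h2)
    refine ⟨rfl, rfl, rfl, g, ?_⟩
    rw [map_rowCast_rfl]
    exact congrArg Subtype.val hg
  · rintro ⟨h₁, h₂, h₃, g, hg⟩
    dsimp only at h₁ h₂ h₃ g hg
    subst h₁ h₂ h₃
    rw [map_rowCast_rfl] at hg
    have h1 : (Quotient.mk _ Γ' : Moduli F ℓ₂ ℓ₃) = Quotient.mk _ Γ :=
      Quotient.sound (MulAction.orbitRel_apply.2 ⟨g, Subtype.ext hg⟩)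
    simp only [Datum.toSW]
    rw [← h1]

end Classification

end WittType

end

theorem theorem3p1 (F : Type*) [Field F] [IsAlgClosed F] [CharZero F] :
    (∀ (ℓ₁ ℓ₂ ℓ₃ ℓ₁' ℓ₂' ℓ₃' : ℕ), 0 < ℓ₁ + ℓ₂ + ℓ₃ → 0 < ℓ₁' + ℓ₂' + ℓ₃' →
      ∀ (Γ : WittType.Omega F ℓ₂ ℓ₃) (Γ' : WittType.Omega F ℓ₂' ℓ₃'),
        Nonempty (WittType.W ℓ₁ Γ ≃ₗ⁅F⁆ WittType.W ℓ₁' Γ') ↔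
          ℓ₁ = ℓ₁' ∧ ∃ (h₂ : ℓ₂ = ℓ₂') (h₃ : ℓ₃ = ℓ₃'), ∃ g : WittType.G F ℓ₂ ℓ₃,
            (g • Γ).1.map (WittType.rowCast h₂ h₃).toAddMonoidHom = Γ'.1) ∧
    ∃ e : WittType.IsoClass F ≃ WittType.SW F,
      ∀ d : WittType.Datum F, e (Quotient.mk _ d) = d.toSW := by
  refine ⟨fun ℓ₁ ℓ₂ ℓ₃ ℓ₁' ℓ₂' ℓ₃' hpos hpos' Γ Γ' =>
    WittType.nonempty_lieEquiv_iff hpos hpos' Γ Γ', ?_⟩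
  have key : ∀ d d' : WittType.Datum F,
      Nonempty (WittType.W d.ℓ₁ d.Γ ≃ₗ⁅F⁆ WittType.W d'.ℓ₁ d'.Γ) ↔ d.toSW = d'.toSW :=
    fun d d' => (WittType.nonempty_lieEquiv_iff d.pos d'.pos d.Γ d'.Γ).trans
      (WittType.Datum.toSW_eq_iff d d').symm
  let f : WittType.IsoClass F → WittType.SW F :=
    Quotient.lift WittType.Datum.toSW fun d d' h => (key d d').1 h
  refine ⟨Equiv.ofBijective f ⟨?_, ?_⟩, fun d => rfl⟩
  · rintro ⟨d⟩ ⟨d'⟩ h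
    exact Quotient.sound ((key d d').2 h)
  · rintro ⟨⟨⟨ℓ₁, ℓ₂, ℓ₃⟩, hl⟩, ⟨Γ⟩⟩
    have hpos : 0 < ℓ₁ + ℓ₂ + ℓ₃ := by
      by_contra h
      exact hl (by simp only [Prod.mk.injEq]; omega)
    exact ⟨Quotient.mk _ ⟨ℓ₁, ℓ₂, ℓ₃, hpos, Γ⟩, rfl⟩
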